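/- Let $k$ be a field of characteristic zero, let $X$ and $S$ be smooth schemes over $k$, and let $i\colon X\hookrightarrow S$ be a closed embedding over $k$ with ideal sheaf $I$. Let $X^{(1)}_S\subset S$ be the first order neighbourhood of $X$ in $S$, i.e. the closed subscheme defined by $I^2$, let $\mu\colon X\to X^{(1)}_S$ be the inclusion, and let $N^\vee_{X/S}=I/I^2$ be the conormal bundle, viewed as an $\mathcal O_X$-module. A first order splitting of $i$ is a morphism of $k$-schemes $\varphi\colon X^{(1)}_S\to X$ with $\varphi\circ\mu=\mathrm{id}_X$. Let $\Omega_X=I_\Delta/I_\Delta^2$ be the conormal sheaf of the diagonal $\Delta\colon X\to X\times_k X$ (when $X$ is not separated, of the closed embedding given by $\Delta$ into an open subscheme of $X\times_k X$), let $\pi_1,\pi_2$ be the two first order splittings of $\Delta$ given by the projections, and let $ds=[\pi_1^\sharp s-\pi_2^\sharp s]\in\Omega_X$ for a local function $s$ on $X$. For two first order splittings $\varphi_1,\varphi_2$ of $i$ and a vector bundle $E$ (of finite rank) on $X$, tensoring $0\to\mu_*N^\vee_{X/S}\to\mathcal O_{X^{(1)}_S}\to\mu_*\mathcal O_X\to 0$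 with $\varphi_1^*E$ and pushing forward along $\varphi_2$ gives, by the projection formula, a short exact sequence of $\mathcal O_X$-modules $$0\to E\otimes N^\vee_{X/S}\to\varphi_{2*}\varphi_1^*E\to E\to 0 .$$ Let $\alpha_{\varphi_1,\varphi_2}(E)\in\mathrm{Ext}^1(E,E\otimes N^\vee_{X/S})$ be its class. The Atiyah class $\mathsf{at}(E)\in\mathrm{Ext}^1(E,E\otimes\Omega_X)$ is the class $\alpha_{\pi_1,\pi_2}(E)$ obtained from the same construction for the diagonal. Proposition. 1. For every first order splitting $\varphi$ of $i$ and every $x\in\mathrm{Hom}_{\mathcal O_X}(\Omega_X,N^\vee_{X/S})$ there is exactly one first order splitting $\varphi+x$ with $(\varphi+x)^\sharp s=\varphi^\sharp s+x(ds)$ for all local functions $s$ on $X$. For fixed $\varphi$, the map $x\mapsto\varphi+x$ is a bijection from $\mathrm{Hom}_{\mathcal O_X}(\Omega_X,N^\vee_{X/S})$ onto the set of first order splittings of $i$. 2. For every vector bundle $E$ on $X$, the sequences above (for any two first order splittings of $i$, and for $\pi_1,\pi_2$) are short exact, with first term identified with $E\otimes N^\vee_{X/S}$, respectively $E\otimes\Omega_X$,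 by the projection formula. For every first order splitting $\varphi$ of $i$, the map $$\Theta_\varphi\colon\mathrm{Hom}_{\mathcal O_X}(\Omega_X,N^\vee_{X/S})\to\mathrm{Ext}^1(E,E\otimes N^\vee_{X/S}),\qquad x\mapsto\alpha_{\varphi+x,\varphi}(E),$$ is $k$-linear, and $\Theta_\varphi(x)=(\mathrm{id}_E\otimes x)\circ\mathsf{at}(E)$ for all $x$. In particular $\Theta_\varphi$ does not depend on $\varphi$. -/

import Mathlib

open CategoryTheory AlgebraicGeometry

universe w u

namespace FirstOrder

noncomputable section

open Limits TensorProduct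

variable {X Y : Scheme.{u}}

/-! ## Sheaves of modules on a scheme -/

/-- The structure sheaf `𝒪_X`, as an `𝒪_X`-module. -/
abbrev structureSheaf (X : Scheme.{u}) : X.Modules := SheafOfModules.unit X.ringCatSheaf

/-- Vector bundles: every point has an open neighbourhood `U` over which `E` is isomorphic to
`𝒪_U ^ n` for some natural number `n`. -/
def IsVectorBundle (E : X.Modules) : Prop :=
  ∀ x : X, ∃ (U : X.Opens) (_ : x ∈ U) (n : ℕ),
    Nonempty (E.restrict U.ι ≅
      (SheafOfModules.free (ULift.{u} (Fin n)) : (U : Scheme.{u}).Modules))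

/-- The presheaf tensor product `U ↦ M(U) ⊗ N(U)`, the tensor product being over `𝒪_X(U)`. -/
abbrev preTensor (M N : X.Modules) : X.PresheafOfModules :=
  PresheafOfModules.Monoidal.tensorObj (R := X.presheaf) M.val N.val

/-- The tensor product `M ⊗ N` of `𝒪_X`-modules: the sheaf associated to the presheaf tensor
product. -/
def tensor (M N : X.Modules) : X.Modules :=
  (PresheafOfModules.sheafification (𝟙 X.ringCatSheaf.obj)).obj (preTensor M N)

/-- The tensor product `a ⊗ b` of two morphisms. -/
def tensorMap {M M' N N' : X.Modules} (a : M ⟶ M') (b : N ⟶ N') : tensor M N ⟶ tensor M' N' :=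
  (PresheafOfModules.sheafification (𝟙 X.ringCatSheaf.obj)).map
    (PresheafOfModules.Monoidal.tensorHom (R := X.presheaf) a.val b.val)

/-- The morphism out of the presheaf tensor product given by compatible bilinear maps. -/
def preTensorDesc {M N P : X.Modules}
    (b : ∀ U : X.Opens, Γ(M, U) →ₗ[Γ(X, U)] Γ(N, U) →ₗ[Γ(X, U)] Γ(P, U))
    (hb : ∀ ⦃U V : X.Opens⦄ (h : U ⟶ V) (m : Γ(M, V)) (n : Γ(N, V)),
      P.presheaf.map h.op (b V m n) = b U (M.presheaf.map h.op m) (N.presheaf.map h.op n)) :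
    preTensor M N ⟶ P.val :=
    { app := fun U ↦ show ModuleCat.of Γ(X, U.unop) (Γ(M, U.unop) ⊗[Γ(X, U.unop)] Γ(N, U.unop)) ⟶
          ModuleCat.of Γ(X, U.unop) Γ(P, U.unop) from
        ModuleCat.ofHom (TensorProduct.lift (b U.unop))
      naturality := by
        intro U V h
        refine ModuleCat.MonoidalCategory.tensor_ext (R := X.presheaf.obj U) fun m n ↦ ?_
        exact (hb h.unop m n).symm }

/-- The morphism `M ⊗ N ⟶ P` given by a family of bilinear maps `M(U) × N(U) → P(U)` which is
compatible with restriction. -/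
def tensorDesc {M N P : X.Modules}
    (b : ∀ U : X.Opens, Γ(M, U) →ₗ[Γ(X, U)] Γ(N, U) →ₗ[Γ(X, U)] Γ(P, U))
    (hb : ∀ ⦃U V : X.Opens⦄ (h : U ⟶ V) (m : Γ(M, V)) (n : Γ(N, V)),
      P.presheaf.map h.op (b V m n) = b U (M.presheaf.map h.op m) (N.presheaf.map h.op n)) :
    tensor M N ⟶ P :=
  (PresheafOfModules.sheafificationHomEquiv (𝟙 X.ringCatSheaf.obj)
    (P := preTensor M N) (F := P)).symm (preTensorDesc b hb)

/-- The canonical morphism from the presheaf tensor product to the tensor product. -/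
def preTensorToTensor (M N : X.Modules) : preTensor M N ⟶ (tensor M N).val :=
  PresheafOfModules.sheafificationHomEquiv (𝟙 X.ringCatSheaf.obj) (𝟙 (tensor M N))

/-- The section `m ⊗ n` of `M ⊗ N` over `U`, for sections `m` and `n` of `M` and `N`. -/
def tmul (M N : X.Modules) (U : X.Opens) :
    Γ(M, U) →ₗ[Γ(X, U)] Γ(N, U) →ₗ[Γ(X, U)] Γ(tensor M N, U) :=
  TensorProduct.mk Γ(X, U) Γ(M, U) Γ(N, U) |>.compr₂
    ((preTensorToTensor M N).app (.op U)).hom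

lemma map_tmul (M N : X.Modules) ⦃U V : X.Opens⦄ (h : U ⟶ V) (m : Γ(M, V)) (n : Γ(N, V)) :
    (tensor M N).presheaf.map h.op (tmul M N V m n) =
      tmul M N U (M.presheaf.map h.op m) (N.presheaf.map h.op n) :=
  (PresheafOfModules.naturality_apply (preTensorToTensor M N) h.op (m ⊗ₜ n)).symm

lemma tensorDesc_tmul {M N P : X.Modules}
    (b : ∀ U : X.Opens, Γ(M, U) →ₗ[Γ(X, U)] Γ(N, U) →ₗ[Γ(X, U)] Γ(P, U)) (hb)
    (U : X.Opens) (m : Γ(M, U)) (n : Γ(N, U)) :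
    (tensorDesc b hb).app U (tmul M N U m n) = b U m n := by
  have h := (PresheafOfModules.sheafificationHomEquiv (𝟙 X.ringCatSheaf.obj)
    (P := preTensor M N) (F := P)).apply_symm_apply (preTensorDesc b hb)
  exact congr($(congr_arg (fun φ : preTensor M N ⟶ P.val ↦ φ.app (.op U)) h) (m ⊗ₜ n))

lemma tensor_hom_ext {M N P : X.Modules} {a b : tensor M N ⟶ P}
    (h : ∀ U m n, a.app U (tmul M N U m n) = b.app U (tmul M N U m n)) : a = b := by
  apply (PresheafOfModules.sheafificationHomEquiv (𝟙 X.ringCatSheaf.obj)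
    (P := preTensor M N) (F := P)).injective
  ext1 U
  exact ModuleCat.MonoidalCategory.tensor_ext (R := X.presheaf.obj U) fun m n ↦ h U.unop m n

/-- The canonical morphism `f_* M ⊗ f_* N ⟶ f_* (M ⊗ N)`, `m ⊗ n ↦ m ⊗ n`. -/
def pushforwardTensor (f : X ⟶ Y) (M N : X.Modules) :
    tensor ((Scheme.Modules.pushforward f).obj M) ((Scheme.Modules.pushforward f).obj N) ⟶
      (Scheme.Modules.pushforward f).obj (tensor M N) :=
  tensorDesc
    (fun U ↦ LinearMap.mk₂ Γ(Y, U)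
      (fun (m : Γ(M, f ⁻¹ᵁ U)) (n : Γ(N, f ⁻¹ᵁ U)) ↦
        (show Γ((Scheme.Modules.pushforward f).obj (tensor M N), U) from
          tmul M N (f ⁻¹ᵁ U) m n))
      (fun m m' n ↦ LinearMap.map_add₂ (tmul M N (f ⁻¹ᵁ U)) m m' n)
      (fun r m n ↦ LinearMap.map_smul₂ (tmul M N (f ⁻¹ᵁ U)) (f.app U r) m n)
      (fun m n n' ↦ LinearMap.map_add (tmul M N (f ⁻¹ᵁ U) m) n n')
      (fun r m n ↦ LinearMap.map_smul (tmul M N (f ⁻¹ᵁ U) m) (f.app U r) n))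
    (fun _ _ h m n ↦ map_tmul M N ((TopologicalSpace.Opens.map f.base).map h) m n)

/-- The canonical morphism `f^* (M ⊗ N) ⟶ f^* M ⊗ f^* N`. -/
def pullbackTensor (f : X ⟶ Y) (M N : Y.Modules) :
    (Scheme.Modules.pullback f).obj (tensor M N) ⟶
      tensor ((Scheme.Modules.pullback f).obj M) ((Scheme.Modules.pullback f).obj N) :=
  ((Scheme.Modules.pullbackPushforwardAdjunction f).homEquiv _ _).symm
    (tensorMap ((Scheme.Modules.pullbackPushforwardAdjunction f).unit.app M)
      ((Scheme.Modules.pullbackPushforwardAdjunction f).unit.app N) ≫ pushforwardTensor f _ _)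

/-- The morphism `𝒪_Y ⟶ f_* 𝒪_X`. -/
def pushUnit (f : X ⟶ Y) :
    structureSheaf Y ⟶ (Scheme.Modules.pushforward f).obj (structureSheaf X) :=
  SheafOfModules.unitToPushforwardObjUnit f.toRingCatSheafHom

/-- The ideal sheaf of `f : X ⟶ Y`, as an `𝒪_Y`-module: the kernel of `𝒪_Y ⟶ f_* 𝒪_X`. -/
def ideal (f : X ⟶ Y) : Y.Modules := kernel (pushUnit f)

/-- The inclusion of the ideal sheaf of `f` into `𝒪_Y`. -/
def idealι (f : X ⟶ Y) : ideal f ⟶ structureSheaf Y := kernel.ι (pushUnit f)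

/-- A section of the ideal sheaf of `f`, as a function on `Y`. -/
def idealVal (f : X ⟶ Y) (U : Y.Opens) (j : Γ(ideal f, U)) : Γ(Y, U) := (idealι f).app U j

lemma app_idealVal (f : X ⟶ Y) (U : Y.Opens) (j : Γ(ideal f, U)) :
    f.app U (idealVal f U j) = 0 :=
  congr(Scheme.Modules.Hom.app $(kernel.condition (pushUnit f)) U j)

lemma exists_idealVal_eq (f : X ⟶ Y) (U : Y.Opens) (r : Γ(Y, U)) (hr : f.app U r = 0) :
    ∃ j, idealVal f U j = r := by
  let F : Y.Modules ⥤ Ab := Scheme.Modules.toPresheaf Y ⋙ (evaluation _ _).obj (.op U)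
  have : F.Additive := { map_add := rfl }
  have : PreservesLimitsOfShape WalkingParallelPair
      ((evaluation Y.Opensᵒᵖ Ab.{u}).obj (.op U)) := by
    have : HasLimitsOfShape WalkingParallelPair Ab.{u} := inferInstance
    exact evaluation_preservesLimitsOfShape _
  have : PreservesLimitsOfShape WalkingParallelPair F := comp_preservesLimitsOfShape _ _
  let C := ShortComplex.mk (idealι f) (pushUnit f) (kernel.condition (pushUnit f))
  have hC : (C.map F).Exact := ShortComplex.exact_of_f_is_kernel _
    (isLimitForkMapOfIsLimit' F C.zero (kernelIsKernel (pushUnit f)))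
  exact (ShortComplex.ab_exact_iff _).1 hC r hr

/-- The multiplication `M ⊗ J ⟶ M`, `m ⊗ j ↦ j • m`, where `J` is the ideal sheaf of `f`:
the inclusion `J ⟶ 𝒪_Y` tensored with `M`, followed by `M ⊗ 𝒪_Y = M`. -/
def idealAction (f : X ⟶ Y) (M : Y.Modules) : tensor M (ideal f) ⟶ M :=
  tensorDesc
    (fun U ↦ LinearMap.mk₂ Γ(Y, U) (fun m j ↦ idealVal f U j • m)
      (fun m m' j ↦ smul_add _ m m')
      (fun r m j ↦ smul_comm _ _ _)
      (fun m j j' ↦ by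
        rw [← add_smul]; congr 1; exact map_add ((idealι f).app U).hom j j')
      (fun r m j ↦ by
        rw [← mul_smul]; congr 1; exact (idealι f).app_smul r j))
    (fun U V h m j ↦ by
      simp only [LinearMap.mk₂_apply, Scheme.Modules.map_smul]
      congr 1
      exact congr($((idealι f).mapPresheaf.naturality h.op) j).symm)

lemma idealAction_unit (f : X ⟶ Y) (M : Y.Modules) :
    idealAction f M ≫ (Scheme.Modules.pullbackPushforwardAdjunction f).unit.app M = 0 := by
  refine tensor_hom_ext fun U m j ↦ ?_
  rw [Scheme.Modules.Hom.comp_app]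
  change ((Scheme.Modules.pullbackPushforwardAdjunction f).unit.app M).app U
    ((idealAction f M).app U (tmul _ _ U m j)) = 0
  rw [idealAction, tensorDesc_tmul]
  refine (Scheme.Modules.Hom.app_smul _ _ _).trans ?_
  change f.app U (idealVal f U j) •
    (show Γ((Scheme.Modules.pullback f).obj M, f ⁻¹ᵁ U) from _) = 0
  rw [app_idealVal]
  exact zero_smul _ _

/-! ## Retractions of a morphism and the extensions they define -/

variable {Z B : Scheme.{u}}

/-- The conormal sheaf `μ^* J = J / J²` of a closed immersion `μ : X ⟶ Z` with ideal sheaf `J`,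
as an `𝒪_X`-module. -/
def conormal (μ : X ⟶ Z) : X.Modules :=
  (Scheme.Modules.pullback μ).obj (ideal μ)

/-- The retractions of `μ : X ⟶ Z` over `B`, where `f : X ⟶ B` and `h : Z ⟶ B` are the structure
morphisms. -/
@[ext]
structure Retraction (μ : X ⟶ Z) (f : X ⟶ B) (h : Z ⟶ B) where
  hom : Z ⟶ X
  fac : μ ≫ hom = 𝟙 X
  hom_comp : hom ≫ f = h

namespace Retraction

variable {μ : X ⟶ Z} {f : X ⟶ B} {h : Z ⟶ B}

/-- The canonical isomorphism `μ^* φ^* E = E`. -/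
def pullbackIso (φ : Retraction μ f h) (E : X.Modules) :
    (Scheme.Modules.pullback μ).obj ((Scheme.Modules.pullback φ.hom).obj E) ≅ E :=
  (Scheme.Modules.pullbackComp μ φ.hom ≪≫
    Scheme.Modules.pullbackCongr φ.fac ≪≫ Scheme.Modules.pullbackId X).app E

/-- The canonical isomorphism `φ_* μ_* M = M`. -/
def pushforwardIso (φ : Retraction μ f h) (M : X.Modules) :
    (Scheme.Modules.pushforward φ.hom).obj ((Scheme.Modules.pushforward μ).obj M) ≅ M :=
  (Scheme.Modules.pushforwardComp μ φ.hom ≪≫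
    Scheme.Modules.pushforwardCongr φ.fac ≪≫ Scheme.Modules.pushforwardId X).app M

/-- The morphism `φ₂_* φ₁^* E ⟶ φ₂_* μ_* μ^* φ₁^* E = E`. -/
def quotientMap (φ₁ φ₂ : Retraction μ f h) (E : X.Modules) :
    (Scheme.Modules.pushforward φ₂.hom).obj ((Scheme.Modules.pullback φ₁.hom).obj E) ⟶ E :=
  (Scheme.Modules.pushforward φ₂.hom).map
      ((Scheme.Modules.pullbackPushforwardAdjunction μ).unit.app _) ≫
    (φ₂.pushforwardIso _).hom ≫ (φ₁.pullbackIso E).hom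

/-- The sequence `0 ⟶ φ₂_* (φ₁^* E ⊗ J) ⟶ φ₂_* φ₁^* E ⟶ E ⟶ 0`: the sequence
`0 ⟶ J ⟶ 𝒪_Z ⟶ μ_* 𝒪_X ⟶ 0` is tensored with `φ₁^* E` and pushed forward by `φ₂`. -/
@[simps]
def extension (φ₁ φ₂ : Retraction μ f h) (E : X.Modules) : ShortComplex X.Modules where
  X₁ := (Scheme.Modules.pushforward φ₂.hom).obj
    (tensor ((Scheme.Modules.pullback φ₁.hom).obj E) (ideal μ))
  X₂ := (Scheme.Modules.pushforward φ₂.hom).obj ((Scheme.Modules.pullback φ₁.hom).obj E)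
  X₃ := E
  f := (Scheme.Modules.pushforward φ₂.hom).map (idealAction _ _)
  g := quotientMap φ₁ φ₂ E
  zero := by
    rw [quotientMap, ← Category.assoc, ← Functor.map_comp, idealAction_unit, Functor.map_zero,
      zero_comp]

/-- The projection formula `φ₂_* (φ₁^* E ⊗ J) = φ₂_* μ_* (μ^* φ₁^* E ⊗ μ^* J) = E ⊗ μ^* J`, which
identifies the first term of `extension φ₁ φ₂ E`. -/
def projectionFormula (φ₁ φ₂ : Retraction μ f h) (E : X.Modules) :
    (extension φ₁ φ₂ E).X₁ ⟶ tensor E (conormal μ) :=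
  (Scheme.Modules.pushforward φ₂.hom).map
      ((Scheme.Modules.pullbackPushforwardAdjunction μ).homEquiv _ _
        (pullbackTensor μ _ _ ≫ tensorMap (φ₁.pullbackIso E).hom (𝟙 (conormal μ)))) ≫
    (φ₂.pushforwardIso _).hom

/-- The class in `Ext¹(E, E ⊗ μ^* J)` of the extension
`0 ⟶ E ⊗ μ^* J ⟶ φ₂_* φ₁^* E ⟶ E ⟶ 0`. -/
def atiyahClass [HasExt.{w} X.Modules] (φ₁ φ₂ : Retraction μ f h) (E : X.Modules)
    (hE : (extension φ₁ φ₂ E).ShortExact) : Abelian.Ext.{w} E (tensor E (conormal μ)) 1 :=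
  hE.extClass.comp (Abelian.Ext.mk₀ (projectionFormula φ₁ φ₂ E)) (add_zero 1)

/-- The open subset `φ₁⁻¹ U ∩ φ₂⁻¹ U` of `Z`; both preimages agree when `μ` is a
homeomorphism. -/
def common (φ₁ φ₂ : Retraction μ f h) (U : X.Opens) : Z.Opens :=
  φ₁.hom ⁻¹ᵁ U ⊓ φ₂.hom ⁻¹ᵁ U

lemma preimage_common (φ₁ φ₂ : Retraction μ f h) (U : X.Opens) :
    μ ⁻¹ᵁ common φ₁ φ₂ U = U := by
  rw [common, Scheme.Hom.preimage_inf, ← Scheme.Hom.comp_preimage, ← Scheme.Hom.comp_preimage,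
    φ₁.fac, φ₂.fac]
  simp

/-- The function `φ₁^♯ s - φ₂^♯ s` on `Z`, for a function `s` on an open subset `U` of `X`. -/
def diffFun (φ₁ φ₂ : Retraction μ f h) (U : X.Opens) (s : Γ(X, U)) :
    Γ(Z, common φ₁ φ₂ U) :=
  φ₁.hom.appLE U _ inf_le_left s - φ₂.hom.appLE U _ inf_le_right s

lemma app_appLE (φ : Retraction μ f h) (U : X.Opens) (V : Z.Opens) (hV : V ≤ φ.hom ⁻¹ᵁ U)
    (hU : μ ⁻¹ᵁ V ≤ U) (s : Γ(X, U)) :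
    μ.app V (φ.hom.appLE U V hV s) = X.presheaf.map (homOfLE hU).op s := by
  have key : φ.hom.appLE U V hV ≫ μ.app V = X.presheaf.map (homOfLE hU).op := by
    have e := φ.fac
    have := Scheme.Hom.appLE_comp_appLE μ φ.hom U V (μ ⁻¹ᵁ V) hV le_rfl
    rw [Scheme.Hom.app_eq_appLE, this]
    simp only [e]
    rw [Scheme.Hom.appLE, Scheme.Hom.id_app]
    exact Category.id_comp _
  exact congr($key s)

lemma app_diffFun (φ₁ φ₂ : Retraction μ f h) (U : X.Opens) (s : Γ(X, U)) :
    μ.app _ (diffFun φ₁ φ₂ U s) = 0 := by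
  refine (map_sub (μ.app (common φ₁ φ₂ U)).hom _ _).trans ?_
  refine sub_eq_zero.2 ?_
  exact (app_appLE φ₁ U _ _ (preimage_common φ₁ φ₂ U).le s).trans
    (app_appLE φ₂ U _ _ (preimage_common φ₁ φ₂ U).le s).symm

/-- The section of the conormal sheaf `μ^* J = J / J²` over `U` defined by the section
`φ₁^♯ s - φ₂^♯ s` of `J`. -/
def diff (φ₁ φ₂ : Retraction μ f h) (U : X.Opens) (s : Γ(X, U)) : Γ(conormal μ, U) :=
  (conormal μ).presheaf.map (homOfLE (preimage_common φ₁ φ₂ U).ge).op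
    (((Scheme.Modules.pullbackPushforwardAdjunction μ).unit.app
      (ideal μ)).app (common φ₁ φ₂ U)
        (exists_idealVal_eq μ _ _ (app_diffFun φ₁ φ₂ U s)).choose)

end Retraction

/-! ## The first order neighbourhood and first order splittings -/

section Neighbourhood

variable {S : Scheme.{u}}

/-- The first order neighbourhood of `X` in `S`: the closed subscheme of `S` defined by `I²`, where
`I` is the ideal of the closed immersion `i : X ⟶ S`. -/
def nbhd (i : X ⟶ S) : Scheme.{u} := (i.ker ^ 2).subscheme

/-- The inclusion of the first order neighbourhood into `S`. -/
def nbhdι (i : X ⟶ S) : nbhd i ⟶ S := (i.ker ^ 2).subschemeι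

lemma ker_nbhdι_le (i : X ⟶ S) : (nbhdι i).ker ≤ i.ker :=
  (Scheme.IdealSheafData.ker_subschemeι _).trans_le (fun _ ↦ Ideal.pow_le_self two_ne_zero)

instance (i : X ⟶ S) : IsClosedImmersion (nbhdι i) :=
  inferInstanceAs (IsClosedImmersion (i.ker ^ 2).subschemeι)

/-- The inclusion of `X` into its first order neighbourhood in `S`. -/
def toNbhd (i : X ⟶ S) : X ⟶ nbhd i :=
  IsClosedImmersion.lift (nbhdι i) i (ker_nbhdι_le i)

lemma toNbhd_nbhdι (i : X ⟶ S) : toNbhd i ≫ nbhdι i = i :=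
  IsClosedImmersion.lift_fac _ _ _

/-- The conormal bundle of the closed immersion `i`, that is `I / I²` as an `𝒪_X`-module. The sheaf
`I / I²` is the ideal sheaf of `X` in its first order neighbourhood. -/
abbrev conormalBundle (i : X ⟶ S) : X.Modules := conormal (toNbhd i)

/-- The first order splittings of `i : X ⟶ S`, where `X` and `S` are schemes over `B`: the
`B`-morphisms from the first order neighbourhood of `X` in `S` to `X` that are left inverse to the
inclusion of `X`. -/
abbrev Splitting (i : X ⟶ S) (f : X ⟶ B) (g : S ⟶ B) := Retraction (toNbhd i) f (nbhdι i ≫ g)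

end Neighbourhood

/-! ## The diagonal -/

section Diagonal

variable (f : X ⟶ B)

/-- The diagonal of `X` over `B`, as a closed immersion into the largest open subset of `X ×_B X`
in which it is closed (this is all of `X ×_B X` when `X` is separated over `B`). -/
def diag : X ⟶ (pullback.diagonal f).coborderRange := (pullback.diagonal f).liftCoborder

/-- The structure morphism to `B` of this open subset of `X ×_B X`. -/
def diagBase : ((pullback.diagonal f).coborderRange : Scheme.{u}) ⟶ B :=
  (pullback.diagonal f).coborderRange.ι ≫ pullback.fst f f ≫ f

/-- The first order splitting `π₁` of the diagonal given by the first projection. -/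
def diagFst : Splitting (diag f) f (diagBase f) where
  hom := nbhdι (diag f) ≫ (pullback.diagonal f).coborderRange.ι ≫ pullback.fst f f
  fac := by
    rw [← Category.assoc, toNbhd_nbhdι, diag, ← Category.assoc, Scheme.Hom.liftCoborder_ι,
      pullback.diagonal_fst]
  hom_comp := by simp [diagBase]

/-- The first order splitting `π₂` of the diagonal given by the second projection. -/
def diagSnd : Splitting (diag f) f (diagBase f) where
  hom := nbhdι (diag f) ≫ (pullback.diagonal f).coborderRange.ι ≫ pullback.snd f f
  fac := by
    rw [← Category.assoc, toNbhd_nbhdι, diag, ← Category.assoc, Scheme.Hom.liftCoborder_ι,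
      pullback.diagonal_snd]
  hom_comp := by simp [diagBase, pullback.condition]

/-- The cotangent sheaf `Ω_{X/B}`: the conormal sheaf of the diagonal. -/
abbrev cotangent : X.Modules := conormalBundle (diag f)

/-- The universal derivation `𝒪_X ⟶ Ω_{X/B}`, `d s = [π₁^♯ s - π₂^♯ s]`. -/
def d (U : X.Opens) (s : Γ(X, U)) : Γ(cotangent f, U) :=
  Retraction.diff (diagFst f) (diagSnd f) U s

end Diagonal

/-- `ψ = φ + x`, for first order splittings `φ` and `ψ` of `i` and `x : Ω_X ⟶ I / I²`:
`ψ^♯ s = φ^♯ s + x (d s)` for all local functions `s` on `X`. -/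
def IsTranslate {S : Scheme.{u}} {i : X ⟶ S} {f : X ⟶ B} {g : S ⟶ B} (φ : Splitting i f g)
    (x : cotangent f ⟶ conormalBundle i) (ψ : Splitting i f g) : Prop :=
  ∀ (U : X.Opens) (s : Γ(X, U)), Retraction.diff ψ φ U s = x.app U (d f U s)

/-! ## The linear structure on the category of modules over a scheme over `k` -/

section Linear

variable {k : Type u} [CommRing k]

/-- The structure morphism `k → 𝒪_X(U)` of a scheme over `k`. -/
def globalScalar (f : X ⟶ Spec (.of k)) (U : X.Opens) : k →+* Γ(X, U) :=
  (f.appLE ⊤ U le_top).hom.comp (Scheme.ΓSpecIso (.of k)).inv.hom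

lemma map_globalScalar (f : X ⟶ Spec (.of k)) {U V : X.Opens} (h : U ⟶ V) (c : k) :
    X.presheaf.map h.op (globalScalar f V c) = globalScalar f U c :=
  congr($(Scheme.Hom.appLE_map f (U := ⊤) (V := V) le_top h.op) ((Scheme.ΓSpecIso (.of k)).inv c))

/-- Multiplication by `c : k` on an `𝒪_X`-module. -/
def scalarEnd (f : X ⟶ Spec (.of k)) (M : X.Modules) (c : k) : M ⟶ M where
  val :=
    { app := fun U ↦ show ModuleCat.of Γ(X, U.unop) Γ(M, U.unop) ⟶
          ModuleCat.of Γ(X, U.unop) Γ(M, U.unop) from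
        ModuleCat.ofHom (globalScalar f U.unop c • LinearMap.id)
      naturality := by
        intro U V h
        ext m
        have := M.map_smul h.unop (globalScalar f U.unop c) m
        rw [map_globalScalar] at this
        exact this.symm }

lemma modules_hom_ext {M N : X.Modules} {a b : M ⟶ N}
    (h : ∀ U (m : Γ(M, U)), a.app U m = b.app U m) : a = b := by
  ext U m
  exact h U m

lemma comp_scalarEnd (f : X ⟶ Spec (.of k)) {M N : X.Modules} (a : M ⟶ N) (c : k) :
    a ≫ scalarEnd f N c = scalarEnd f M c ≫ a :=
  modules_hom_ext fun U m ↦ (a.app_smul (globalScalar f U c) m).symm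

/-- The `k`-linear structure on the category of `𝒪_X`-modules, for a scheme `X` over `k`. It makes
`Hom` and `Ext` of `𝒪_X`-modules into `k`-modules. -/
abbrev linearOver (f : X ⟶ Spec (.of k)) : Linear k X.Modules where
  homModule M N :=
    { smul := fun c a ↦ a ≫ scalarEnd f N c
      one_smul := fun a ↦ modules_hom_ext fun U m ↦ by
        change globalScalar f U 1 • a.app U m = a.app U m
        rw [map_one, one_smul]
      mul_smul := fun c c' a ↦ modules_hom_ext fun U m ↦ by
        change globalScalar f U (c * c') • a.app U m =
          globalScalar f U c • globalScalar f U c' • a.app U m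
        rw [map_mul, mul_smul]
      smul_zero := fun c ↦ zero_comp
      smul_add := fun c a b ↦ Preadditive.add_comp _ _ _ _ _ _
      add_smul := fun c c' a ↦ modules_hom_ext fun U m ↦ by
        change globalScalar f U (c + c') • a.app U m =
          globalScalar f U c • a.app U m + globalScalar f U c' • a.app U m
        rw [map_add, add_smul]
      zero_smul := fun a ↦ modules_hom_ext fun U m ↦ by
        change globalScalar f U 0 • a.app U m = 0
        rw [map_zero, zero_smul] }
  smul_comp M N P c a b := by
    change (a ≫ scalarEnd f N c) ≫ b = (a ≫ b) ≫ scalarEnd f P c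
    rw [Category.assoc, Category.assoc, comp_scalarEnd]
  comp_smul M N P a c b := (Category.assoc _ _ _).symm

end Linear

end

end FirstOrder

/-! Everything is done for a retraction `φ` of a square zero thickening `μ : X ⟶ Z` with ideal `J`.
The retraction splits functions as `r = φ^♯ μ^♯ r + (r - φ^♯ μ^♯ r)`, so that `𝒪_Z` is `𝒪_X ⊕ J`
with `J = J / J²`, and `δ r = [r - φ^♯ μ^♯ r]` is a derivation `𝒪_Z → J / J²`. The two
neighbourhoods in the theorem are instances (`isSquareZero_toNbhd`).

Translation. Let `Z` and `Z'` be two such thickenings of `X`, retracted by `φ` and `π`. A morphism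
`x` of conormal sheaves gives a morphism of thickenings `r ↦ φ^♯ μ'^♯ r + x (δ r)`, multiplicative
because `J² = 0`, and `x` is recovered from it (`conormalMap_thicken`). For `Z' = nbhd (diag f)` and
`π = π₂` this is a morphism `θ` with `π₂ θ = φ`, and `φ + x` is `π₁ θ`. Conversely a pair of
splittings `(ψ, φ)` maps `Z` to `X ×_B X`, and uniquely to the first order neighbourhood of the
diagonal (`toDiag`, `eq_toDiag`), because `J² = 0` kills the square of the ideal of the diagonal.
Pulling back `π₁^♯ s - π₂^♯ s` along `θ` gives `ψ^♯ s - φ^♯ s` (`conormalMap_diff`), which is the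
defining property of `φ + x`.

Exactness. The module `φ^* E` is compared with `E ⊕ E ⊗ J / J²`, on which `r` acts by `(e, w) ↦ (r
e, r w + e ⊗ δ r)`. The comparison decomposes every section of `φ^* E` (`pullSec_add_idealAction`)
and identifies `φ^* E ⊗ J` with its image and with `E ⊗ J / J²` (`toSum_idealAction`,
`projInvSec_proj`).

Atiyah classes. The extension is functorial in `θ`, with the identity on `E` and `id ⊗ x` on the
kernels, so naturality of extension classes gives `Θ_φ(x) = (id ⊗ x) ∘ at(E)` (`atiyahClass_eq`).
Linearity and independence of `φ` can be read off from this formula. -/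

namespace FirstOrder

noncomputable section

open Limits TensorProduct

/-! ## Sections of sheaves of modules -/

section Sections

variable {X Y Z : Scheme.{u}}

/-- Restriction of functions. -/
def fres {U V : X.Opens} (h : U ≤ V) : Γ(X, V) →+* Γ(X, U) := (X.presheaf.map (homOfLE h).op).hom

/-- Restriction of sections of a module. -/
def res (M : X.Modules) {U V : X.Opens} (h : U ≤ V) : Γ(M, V) →+ Γ(M, U) :=
  (M.presheaf.map (homOfLE h).op).hom

@[simp]
lemma fres_fres {U V W : X.Opens} (h : U ≤ V) (h' : V ≤ W) (r : Γ(X, W)) :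
    fres h (fres h' r) = fres (h.trans h') r :=
  congr($(X.presheaf.map_comp (homOfLE h').op (homOfLE h).op) r).symm

@[simp]
lemma fres_self {U : X.Opens} (h : U ≤ U) (r : Γ(X, U)) : fres h r = r :=
  congr($(X.presheaf.map_id (.op U)) r)

@[simp]
lemma res_res (M : X.Modules) {U V W : X.Opens} (h : U ≤ V) (h' : V ≤ W) (m : Γ(M, W)) :
    res M h (res M h' m) = res M (h.trans h') m :=
  congr($(M.presheaf.map_comp (homOfLE h').op (homOfLE h).op) m).symm

@[simp]
lemma res_self (M : X.Modules) {U : X.Opens} (h : U ≤ U) (m : Γ(M, U)) : res M h m = m :=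
  congr($(M.presheaf.map_id (.op U)) m)

lemma res_smul (M : X.Modules) {U V : X.Opens} (h : U ≤ V) (r : Γ(X, V)) (m : Γ(M, V)) :
    res M h (r • m) = fres h r • res M h m :=
  M.map_smul (homOfLE h) r m

lemma res_injective (M : X.Modules) {U V : X.Opens} (h : U ≤ V) (h' : V ≤ U) :
    Function.Injective (res M h) := fun a b e ↦ by
  simpa using congr(res M h' $e)

lemma fres_app (f : X ⟶ Y) {U V : Y.Opens} (h : U ≤ V) (r : Γ(Y, V)) :
    f.app U (fres h r) = fres (f.preimage_mono h) (f.app V r) :=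
  congr($(f.naturality (homOfLE h).op) r)

variable {M N P : X.Modules}

lemma app_res (a : M ⟶ N) {U V : X.Opens} (h : U ≤ V) (m : Γ(M, V)) :
    a.app U (res M h m) = res N h (a.app V m) :=
  congr($(a.mapPresheaf.naturality (homOfLE h).op) m)

/-- A morphism of modules, from its action on sections. -/
def homMk (a : ∀ U : X.Opens, Γ(M, U) →ₗ[Γ(X, U)] Γ(N, U))
    (ha : ∀ ⦃U V : X.Opens⦄ (h : U ≤ V) (m : Γ(M, V)), a U (res M h m) = res N h (a V m)) :
    M ⟶ N where
  val :=
    { app := fun U ↦ show ModuleCat.of Γ(X, U.unop) Γ(M, U.unop) ⟶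
          ModuleCat.of Γ(X, U.unop) Γ(N, U.unop) from ModuleCat.ofHom (a U.unop)
      naturality := by
        intro U V h
        ext m
        exact ha (leOfHom h.unop) m }

lemma section_ext {U : X.Opens} {m n : Γ(M, U)}
    (h : ∀ x ∈ U, ∃ (V : X.Opens) (hV : V ≤ U), x ∈ V ∧ res M hV m = res M hV n) : m = n := by
  choose V hV hx e using h
  exact TopCat.Sheaf.eq_of_locally_eq' ⟨M.presheaf, M.isSheaf⟩ (fun x : U ↦ V x.1 x.2) U
    (fun x ↦ homOfLE (hV x.1 x.2)) (fun x hxU ↦ TopologicalSpace.Opens.mem_iSup.2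
      ⟨⟨x, hxU⟩, hx x hxU⟩) m n (fun x ↦ e x.1 x.2)

lemma isIso_of_bijective (a : M ⟶ N) (h : ∀ U, Function.Bijective (a.app U)) : IsIso a := by
  rw [Scheme.Modules.Hom.isIso_iff_isIso_app]
  intro U
  rw [ConcreteCategory.isIso_iff_bijective]
  exact h U

lemma mono_of_injective (a : M ⟶ N) (h : ∀ U, Function.Injective (a.app U)) : Mono a where
  right_cancellation _ _ e := modules_hom_ext fun U m ↦ h U congr($(e).app U m)

lemma epi_of_surjective (a : M ⟶ N) (h : ∀ U, Function.Surjective (a.app U)) : Epi a where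
  left_cancellation _ _ e := modules_hom_ext fun U m ↦ by
    obtain ⟨m, rfl⟩ := h U m
    exact congr($(e).app U m)

lemma injective_of_mono (a : M ⟶ N) [Mono a] (U : X.Opens) : Function.Injective (a.app U) := by
  have : Mono ((Scheme.Modules.toPresheaf X).map a) := inferInstance
  have : Mono (((Scheme.Modules.toPresheaf X).map a).app (.op U)) := inferInstance
  exact (AddCommGrpCat.mono_iff_injective _).1 this

/-- Exactness over every open set is more than exactness of sheaves. It is available for the
extensions here because a retraction splits them as sequences of abelian sheaves. -/
lemma shortExact_of_sections (C : ShortComplex X.Modules)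
    (inj : ∀ U, Function.Injective (C.f.app U)) (surj : ∀ U, Function.Surjective (C.g.app U))
    (ex : ∀ U (m : Γ(C.X₂, U)), C.g.app U m = 0 → ∃ n, C.f.app U n = m) : C.ShortExact where
  mono_f := mono_of_injective _ inj
  epi_g := epi_of_surjective _ surj
  exact := by
    rw [ShortComplex.exact_iff_epi_kernel_lift]
    refine epi_of_surjective _ fun U m ↦ ?_
    obtain ⟨n, hn⟩ := ex U ((kernel.ι C.g).app U m)
      congr($(kernel.condition C.g).app U m)
    refine ⟨n, injective_of_mono (kernel.ι C.g) U ?_⟩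
    rw [← hn]
    exact congr($(kernel.lift_ι C.g C.f C.zero).app U n)

/-! ### Pullbacks -/

/-- The pullback of a section along a morphism. -/
def pull (f : X ⟶ Y) (M : Y.Modules) (U : Y.Opens) :
    Γ(M, U) →+ Γ((Scheme.Modules.pullback f).obj M, f ⁻¹ᵁ U) :=
  (((Scheme.Modules.pullbackPushforwardAdjunction f).unit.app M).app U).hom

lemma pull_smul (f : X ⟶ Y) (M : Y.Modules) (U : Y.Opens) (r : Γ(Y, U)) (m : Γ(M, U)) :
    pull f M U (r • m) = f.app U r • pull f M U m :=
  ((Scheme.Modules.pullbackPushforwardAdjunction f).unit.app M).app_smul r m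

lemma pull_res (f : X ⟶ Y) (M : Y.Modules) {U V : Y.Opens} (h : U ≤ V) (m : Γ(M, V)) :
    pull f M U (res M h m) = res _ (f.preimage_mono h) (pull f M V m) :=
  app_res ((Scheme.Modules.pullbackPushforwardAdjunction f).unit.app M) h m

/-- The action on sections of a morphism into a pushforward. -/
def appTo (f : X ⟶ Y) {M : Y.Modules} {N : X.Modules}
    (a : M ⟶ (Scheme.Modules.pushforward f).obj N) (U : Y.Opens) : Γ(M, U) →+ Γ(N, f ⁻¹ᵁ U) :=
  (a.app U).hom

lemma appTo_res (f : X ⟶ Y) {M : Y.Modules} {N : X.Modules}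
    (a : M ⟶ (Scheme.Modules.pushforward f).obj N) {U V : Y.Opens} (h : U ≤ V) (m : Γ(M, V)) :
    appTo f a U (res M h m) = res N (f.preimage_mono h) (appTo f a V m) :=
  app_res a h m

lemma appTo_smul (f : X ⟶ Y) {M : Y.Modules} {N : X.Modules}
    (a : M ⟶ (Scheme.Modules.pushforward f).obj N) (U : Y.Opens) (r : Γ(Y, U)) (m : Γ(M, U)) :
    appTo f a U (r • m) = f.app U r • appTo f a U m :=
  a.app_smul r m

/-- A morphism out of a pullback, from its adjoint. -/
def pullDesc (f : X ⟶ Y) {M : Y.Modules} {N : X.Modules}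
    (a : M ⟶ (Scheme.Modules.pushforward f).obj N) : (Scheme.Modules.pullback f).obj M ⟶ N :=
  ((Scheme.Modules.pullbackPushforwardAdjunction f).homEquiv _ _).symm a

lemma homEquiv_app (f : X ⟶ Y) {M : Y.Modules} {N : X.Modules}
    (a : (Scheme.Modules.pullback f).obj M ⟶ N) (U : Y.Opens) (m : Γ(M, U)) :
    appTo f ((Scheme.Modules.pullbackPushforwardAdjunction f).homEquiv _ _ a) U m =
      a.app (f ⁻¹ᵁ U) (pull f M U m) := by
  rw [Adjunction.homEquiv_unit]
  rfl

lemma pullDesc_pull (f : X ⟶ Y) {M : Y.Modules} {N : X.Modules}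
    (a : M ⟶ (Scheme.Modules.pushforward f).obj N) (U : Y.Opens) (m : Γ(M, U)) :
    (pullDesc f a).app (f ⁻¹ᵁ U) (pull f M U m) = appTo f a U m := by
  rw [← homEquiv_app, pullDesc, Equiv.apply_symm_apply]

/-- By adjunction: the pulled back sections generate the pullback. -/
lemma pullback_hom_ext {f : X ⟶ Y} {M : Y.Modules} {N : X.Modules}
    {a b : (Scheme.Modules.pullback f).obj M ⟶ N}
    (h : ∀ U m, a.app (f ⁻¹ᵁ U) (pull f M U m) = b.app (f ⁻¹ᵁ U) (pull f M U m)) : a = b := by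
  apply ((Scheme.Modules.pullbackPushforwardAdjunction f).homEquiv _ _).injective
  refine modules_hom_ext fun U m ↦ ?_
  exact (homEquiv_app f a U m).trans ((h U m).trans (homEquiv_app f b U m).symm)

lemma pullbackId_hom_pull (M : X.Modules) (U : X.Opens) (m : Γ(M, U)) :
    ((Scheme.Modules.pullbackId X).hom.app M).app U (pull (𝟙 X) M U m) = m := by
  have := congr(($(Scheme.Modules.conjugateEquiv_pullbackId_hom X)).app M)
  rw [conjugateEquiv_apply_app] at this
  exact congr($(this).app U m)

lemma pullbackComp_hom_pull (f : X ⟶ Y) (g : Y ⟶ Z) (M : Z.Modules) (U : Z.Opens) (m : Γ(M, U)) :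
    ((Scheme.Modules.pullbackComp f g).hom.app M).app (f ⁻¹ᵁ g ⁻¹ᵁ U)
      (pull f _ (g ⁻¹ᵁ U) (pull g M U m)) = pull (f ≫ g) M U m := by
  have := congr(($(Scheme.Modules.conjugateEquiv_pullbackComp_inv f g)).app
    ((Scheme.Modules.pullback (f ≫ g)).obj M))
  have h2 := unit_conjugateEquiv
    ((Scheme.Modules.pullbackPushforwardAdjunction g).comp
      (Scheme.Modules.pullbackPushforwardAdjunction f))
    (Scheme.Modules.pullbackPushforwardAdjunction (f ≫ g)) (Scheme.Modules.pullbackComp f g).inv M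
  rw [Scheme.Modules.conjugateEquiv_pullbackComp_inv] at h2
  -- Compatibility of the units of the two adjunctions computes the inverse of the comparison on
  -- pulled back sections; the claim follows by cancelling it.
  have h3 := congr($(h2).app U m)
  have h4 : pull f _ (g ⁻¹ᵁ U) (pull g M U m) =
      ((Scheme.Modules.pullbackComp f g).inv.app M).app (f ⁻¹ᵁ g ⁻¹ᵁ U) (pull (f ≫ g) M U m) := by
    refine Eq.trans ?_ h3
    rw [Adjunction.comp_unit_app]
    rfl
  rw [h4]
  exact congr($((Scheme.Modules.pullbackComp f g).inv_hom_id_app M).app (f ⁻¹ᵁ g ⁻¹ᵁ U)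
    (pull (f ≫ g) M U m))

lemma pullbackCongr_hom_pull {f g : X ⟶ Y} (h : f = g) (M : Y.Modules) (U : Y.Opens)
    (m : Γ(M, U)) :
    ((Scheme.Modules.pullbackCongr h).hom.app M).app (f ⁻¹ᵁ U) (pull f M U m) =
      res _ (by rw [h]) (pull g M U m) := by
  subst h
  rw [res_self]
  rfl

/-! ### Tensor products -/

lemma res_tmul (M N : X.Modules) {U V : X.Opens} (h : U ≤ V) (m : Γ(M, V)) (n : Γ(N, V)) :
    res (tensor M N) h (tmul M N V m n) = tmul M N U (res M h m) (res N h n) :=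
  map_tmul M N (homOfLE h) m n

lemma tensorMap_tmul {M M' N N' : X.Modules} (a : M ⟶ M') (b : N ⟶ N') (U : X.Opens)
    (m : Γ(M, U)) (n : Γ(N, U)) :
    (tensorMap a b).app U (tmul M N U m n) = tmul M' N' U (a.app U m) (b.app U n) := by
  have := (PresheafOfModules.sheafificationAdjunction (𝟙 X.ringCatSheaf.obj)).unit.naturality
    (PresheafOfModules.Monoidal.tensorHom (R := X.presheaf) a.val b.val)
  exact congr($(congr_arg (fun φ ↦ PresheafOfModules.Hom.app φ (.op U)) this) (m ⊗ₜ n)).symm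

lemma pushforwardTensor_tmul (f : X ⟶ Y) (M N : X.Modules) (U : Y.Opens)
    (m : Γ(M, f ⁻¹ᵁ U)) (n : Γ(N, f ⁻¹ᵁ U)) :
    (pushforwardTensor f M N).app U (tmul _ _ U m n) = tmul M N (f ⁻¹ᵁ U) m n :=
  tensorDesc_tmul _ _ _ _ _

/-- The presheaf tensor product maps locally surjectively to its sheafification, so a section is
locally a finite sum of pure tensors. This is why `Q` has to be a local property. -/
lemma tensor_induction (M N : X.Modules) {Q : ∀ U : X.Opens, Γ(tensor M N, U) → Prop}
    (loc : ∀ U t, (∀ x ∈ U, ∃ (V : X.Opens) (hV : V ≤ U), x ∈ V ∧ Q V (res _ hV t)) → Q U t)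
    (zero : ∀ U, Q U 0) (add : ∀ U t t', Q U t → Q U t' → Q U (t + t'))
    (tmul : ∀ U m n, Q U (tmul M N U m n)) (U : X.Opens) (t : Γ(tensor M N, U)) : Q U t := by
  have hs : Presheaf.IsLocallySurjective (Opens.grothendieckTopology X)
      ((PresheafOfModules.toPresheaf _).map (preTensorToTensor M N)) :=
    inferInstanceAs (Presheaf.IsLocallySurjective (Opens.grothendieckTopology X)
      (CategoryTheory.toSheafify (Opens.grothendieckTopology X) (preTensor M N).presheaf))
  refine loc U t fun x hx ↦ ?_
  obtain ⟨V, i, ⟨s, hs⟩, hxV⟩ := hs.imageSieve_mem t x hx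
  refine ⟨V, leOfHom i, hxV, ?_⟩
  let L : Γ(M, V) ⊗[Γ(X, V)] Γ(N, V) →ₗ[Γ(X, V)] Γ(tensor M N, V) :=
    ((preTensorToTensor M N).app (.op V)).hom
  have hL : ∀ m n, L (m ⊗ₜ n) = FirstOrder.tmul M N V m n := fun _ _ ↦ rfl
  have e : res (tensor M N) (leOfHom i) t = L s := hs.symm
  rw [e]
  clear_value L
  clear hs e
  change Γ(M, V) ⊗[Γ(X, V)] Γ(N, V) at s
  induction s with
  | zero => rw [map_zero]; exact zero V
  | add a b ha hb => rw [map_add]; exact add V _ _ ha hb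
  | tmul m n => rw [hL]; exact tmul V m n

end Sections

section

variable {X Y Z B : Scheme.{u}}

/-! ## Ideal sheaves of square zero -/

/-- `μ : X ⟶ Z` is surjective and the product of any two sections of its ideal vanishes. -/
structure IsSquareZero (μ : X ⟶ Z) : Prop where
  surjective : Function.Surjective μ
  mul_eq_zero : ∀ (V : Z.Opens) (a b : Γ(Z, V)), μ.app V a = 0 → μ.app V b = 0 → a * b = 0

section Ideal

variable (μ : X ⟶ Z)

lemma idealVal_injective (V : Z.Opens) : Function.Injective (idealVal μ V) :=
  have : Mono (idealι μ) := inferInstanceAs (Mono (kernel.ι (pushUnit μ)))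
  injective_of_mono (idealι μ) V

lemma idealVal_add (V : Z.Opens) (j j' : Γ(ideal μ, V)) :
    idealVal μ V (j + j') = idealVal μ V j + idealVal μ V j' :=
  map_add ((idealι μ).app V).hom j j'

lemma idealVal_smul (V : Z.Opens) (r : Γ(Z, V)) (j : Γ(ideal μ, V)) :
    idealVal μ V (r • j) = r * idealVal μ V j :=
  (idealι μ).app_smul r j

lemma idealVal_res {U V : Z.Opens} (h : U ≤ V) (j : Γ(ideal μ, V)) :
    idealVal μ U (res _ h j) = fres h (idealVal μ V j) :=
  app_res (idealι μ) h j

/-- The class of a section of the ideal sheaf in the conormal sheaf. -/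
def cls (V : Z.Opens) : Γ(ideal μ, V) →+ Γ(conormal μ, μ ⁻¹ᵁ V) := pull μ (ideal μ) V

lemma cls_smul (V : Z.Opens) (r : Γ(Z, V)) (j : Γ(ideal μ, V)) :
    cls μ V (r • j) = μ.app V r • cls μ V j := pull_smul _ _ _ _ _

lemma cls_res {U V : Z.Opens} (h : U ≤ V) (j : Γ(ideal μ, V)) :
    cls μ U (res _ h j) = res _ (μ.preimage_mono h) (cls μ V j) := pull_res _ _ _ _

variable {μ} in
lemma conormal_hom_ext {N : X.Modules} {a b : conormal μ ⟶ N}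
    (h : ∀ V j, a.app (μ ⁻¹ᵁ V) (cls μ V j) = b.app (μ ⁻¹ᵁ V) (cls μ V j)) : a = b :=
  pullback_hom_ext h

/-- A morphism out of the conormal sheaf, from a morphism out of the ideal sheaf. -/
def conormalDesc {N : X.Modules} (a : ideal μ ⟶ (Scheme.Modules.pushforward μ).obj N) :
    conormal μ ⟶ N := pullDesc μ a

lemma conormalDesc_cls {N : X.Modules} (a : ideal μ ⟶ (Scheme.Modules.pushforward μ).obj N)
    (V : Z.Opens) (j : Γ(ideal μ, V)) :
    (conormalDesc μ a).app (μ ⁻¹ᵁ V) (cls μ V j) = appTo μ a V j := pullDesc_pull _ _ _ _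

/-- A function vanishing on `X`, as a section of the ideal sheaf. -/
def idealMk (V : Z.Opens) (r : Γ(Z, V)) (hr : μ.app V r = 0) : Γ(ideal μ, V) :=
  (exists_idealVal_eq μ V r hr).choose

lemma idealVal_idealMk (V : Z.Opens) (r : Γ(Z, V)) (hr : μ.app V r = 0) :
    idealVal μ V (idealMk μ V r hr) = r :=
  (exists_idealVal_eq μ V r hr).choose_spec

lemma idealAction_tmul (M : Z.Modules) (V : Z.Opens) (m : Γ(M, V)) (j : Γ(ideal μ, V)) :
    (idealAction μ M).app V (tmul _ _ V m j) = idealVal μ V j • m :=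
  tensorDesc_tmul _ _ _ _ _

variable {μ}

lemma IsSquareZero.smul_idealAction (hμ : IsSquareZero μ) (M : Z.Modules) (V : Z.Opens)
    (r : Γ(Z, V)) (hr : μ.app V r = 0) (t : Γ(tensor M (ideal μ), V)) :
    r • (idealAction μ M).app V t = 0 := by
  -- The scalar is quantified inside the predicate because passing to a smaller open set restricts
  -- it.
  refine tensor_induction M (ideal μ) (Q := fun V t ↦ ∀ r : Γ(Z, V), μ.app V r = 0 →
    r • (idealAction μ M).app V t = 0) ?_ ?_ ?_ ?_ V t r hr
  · intro U t loc r hr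
    refine section_ext fun x hx ↦ ?_
    obtain ⟨V, hV, hxV, e⟩ := loc x hx
    refine ⟨V, hV, hxV, ?_⟩
    rw [res_smul, ← app_res, e _ (by rw [fres_app, hr, map_zero]), map_zero]
  · intro U r _
    rw [map_zero, smul_zero]
  · intro U t t' ht ht' r hr
    rw [map_add, smul_add, ht r hr, ht' r hr, add_zero]
  · intro U m j r hr
    rw [idealAction_tmul, ← mul_smul, hμ.mul_eq_zero _ _ _ hr (app_idealVal _ _ _), zero_smul]

/-- Since `J² = 0`, the action of `𝒪_Z` on `J` factors through `μ^♯`. -/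
lemma IsSquareZero.smul_congr (hμ : IsSquareZero μ) (V : Z.Opens) (r r' : Γ(Z, V))
    (h : μ.app V r = μ.app V r') (j : Γ(ideal μ, V)) : r • j = r' • j := by
  apply idealVal_injective
  rw [idealVal_smul, idealVal_smul, ← sub_eq_zero, ← sub_mul]
  exact hμ.mul_eq_zero _ _ _ (by rw [map_sub, h, sub_self]) (app_idealVal _ _ _)

end Ideal

/-! ## The geometry of a retraction -/

namespace Retraction

variable {μ : X ⟶ Z} {f : X ⟶ B} {h : Z ⟶ B} (φ : Retraction μ f h)

lemma preimage_preimage (U : X.Opens) : μ ⁻¹ᵁ φ.hom ⁻¹ᵁ U = U := by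
  rw [← Scheme.Hom.comp_preimage, φ.fac]
  rfl

/-- On points `μ` is surjective with left inverse `φ`, so the two are inverse bijections. Open sets
of `X` and `Z` thus correspond, but only up to propositional equality; hence the restrictions along
equal open sets below. -/
lemma preimage_preimage' (hμ : IsSquareZero μ) (V : Z.Opens) : φ.hom ⁻¹ᵁ μ ⁻¹ᵁ V = V := by
  ext z
  obtain ⟨x, rfl⟩ := hμ.surjective z
  have : φ.hom (μ x) = x := by
    rw [← Scheme.Hom.comp_apply, φ.fac]
    rfl
  change μ (φ.hom (μ x)) ∈ V ↔ μ x ∈ V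
  rw [this]

lemma app_app (U : X.Opens) (s : Γ(X, U)) :
    μ.app (φ.hom ⁻¹ᵁ U) (φ.hom.app U s) = fres (φ.preimage_preimage U).le s := by
  have := φ.app_appLE U (φ.hom ⁻¹ᵁ U) le_rfl (φ.preimage_preimage U).le s
  rwa [← Scheme.Hom.app_eq_appLE] at this

/-- The restriction `φ^* E ⟶ μ_* E` to `X`. -/
def quo (E : X.Modules) :
    (Scheme.Modules.pullback φ.hom).obj E ⟶ (Scheme.Modules.pushforward μ).obj E :=
  (Scheme.Modules.pullbackPushforwardAdjunction μ).homEquiv _ _ (φ.pullbackIso E).hom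

/-- Each of the three canonical isomorphisms composing `pullbackIso` respects pulled back sections,
so `φ^* e` restricts to `e`. -/
lemma quo_pull (E : X.Modules) (U : X.Opens) (e : Γ(E, U)) :
    appTo μ (φ.quo E) (φ.hom ⁻¹ᵁ U) (pull φ.hom E U e) = res E (φ.preimage_preimage U).le e := by
  rw [quo, homEquiv_app]
  have h1 := pullbackComp_hom_pull μ φ.hom E U e
  have h2 := pullbackCongr_hom_pull φ.fac E U e
  have h3 := pullbackId_hom_pull E U e
  refine (congr(((Scheme.Modules.pullbackId X).hom.app E).app _
    (((Scheme.Modules.pullbackCongr φ.fac).hom.app E).app ((μ ≫ φ.hom) ⁻¹ᵁ U) $h1))).trans ?_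
  refine (congr(((Scheme.Modules.pullbackId X).hom.app E).app _ $h2)).trans ?_
  exact (app_res _ _ _).trans congr(res E (φ.preimage_preimage U).le $h3)

lemma quotientMap_app (φ₁ φ₂ : Retraction μ f h) (E : X.Modules) (U : X.Opens)
    (m : Γ((Scheme.Modules.pullback φ₁.hom).obj E, φ₂.hom ⁻¹ᵁ U)) :
    (quotientMap φ₁ φ₂ E).app U m =
      res E (φ₂.preimage_preimage U).ge (appTo μ (φ₁.quo E) (φ₂.hom ⁻¹ᵁ U) m) := by
  rw [quo, homEquiv_app]
  exact app_res (φ₁.pullbackIso E).hom (φ₂.preimage_preimage U).ge _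

/-- The projection formula before pushing forward to `X`. -/
def proj (E : X.Modules) :
    tensor ((Scheme.Modules.pullback φ.hom).obj E) (ideal μ) ⟶
      (Scheme.Modules.pushforward μ).obj (tensor E (conormal μ)) :=
  (Scheme.Modules.pullbackPushforwardAdjunction μ).homEquiv _ _
    (pullbackTensor μ _ _ ≫ tensorMap (φ.pullbackIso E).hom (𝟙 (conormal μ)))

lemma proj_tmul (E : X.Modules) (V : Z.Opens)
    (m : Γ((Scheme.Modules.pullback φ.hom).obj E, V)) (j : Γ(ideal μ, V)) :
    appTo μ (φ.proj E) V (tmul _ _ V m j) =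
      tmul E (conormal μ) (μ ⁻¹ᵁ V) (appTo μ (φ.quo E) V m) (cls μ V j) := by
  refine (homEquiv_app μ _ V _).trans ?_
  have h1 := pullDesc_pull μ (tensorMap ((Scheme.Modules.pullbackPushforwardAdjunction μ).unit.app
    ((Scheme.Modules.pullback φ.hom).obj E))
      ((Scheme.Modules.pullbackPushforwardAdjunction μ).unit.app (ideal μ)) ≫
      pushforwardTensor μ _ _) V (tmul _ _ V m j)
  have h2 := tensorMap_tmul ((Scheme.Modules.pullbackPushforwardAdjunction μ).unit.app
    ((Scheme.Modules.pullback φ.hom).obj E))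
      ((Scheme.Modules.pullbackPushforwardAdjunction μ).unit.app (ideal μ)) V m j
  have h3 := pushforwardTensor_tmul μ ((Scheme.Modules.pullback μ).obj
    ((Scheme.Modules.pullback φ.hom).obj E)) ((Scheme.Modules.pullback μ).obj (ideal μ)) V
    (pull μ _ V m) (pull μ _ V j)
  have h4 := tensorMap_tmul (φ.pullbackIso E).hom (𝟙 (conormal μ)) _ (pull μ _ V m) (cls μ V j)
  refine (congrArg _ (h1.trans ((congrArg _ h2).trans h3))).trans (h4.trans ?_)
  rw [quo, homEquiv_app]
  rfl

lemma projectionFormula_app (φ₁ φ₂ : Retraction μ f h) (E : X.Modules) (U : X.Opens)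
    (t : Γ(tensor ((Scheme.Modules.pullback φ₁.hom).obj E) (ideal μ), φ₂.hom ⁻¹ᵁ U)) :
    (projectionFormula φ₁ φ₂ E).app U t =
      res _ (φ₂.preimage_preimage U).ge (appTo μ (φ₁.proj E) (φ₂.hom ⁻¹ᵁ U) t) := rfl

/-! ### The conormal sheaf -/

/-- The isomorphism `J / J² ⟶ φ_* J`. -/
def lift (hμ : IsSquareZero μ) :
    conormal μ ⟶ (Scheme.Modules.pushforward φ.hom).obj (ideal μ) :=
  conormalDesc μ (homMk (N := (Scheme.Modules.pushforward μ).obj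
      ((Scheme.Modules.pushforward φ.hom).obj (ideal μ)))
    (fun V ↦
      { toFun := fun j ↦ (res (ideal μ) (φ.preimage_preimage' hμ V).le j : Γ(ideal μ, _))
        map_add' := fun j j' ↦ map_add _ j j'
        map_smul' := fun r j ↦ by
          refine (res_smul _ _ r j).trans (hμ.smul_congr _ _ (φ.hom.app _ (μ.app V r)) ?_ _)
          rw [app_app, fres_app] })
    (fun U V hUV j ↦ (res_res _ _ _ j).trans (res_res _ _ _ j).symm))

lemma lift_cls (hμ : IsSquareZero μ) (V : Z.Opens) (j : Γ(ideal μ, V)) :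
    appTo φ.hom (φ.lift hμ) (μ ⁻¹ᵁ V) (cls μ V j) =
      res (ideal μ) (φ.preimage_preimage' hμ V).le j :=
  conormalDesc_cls _ _ _ _

/-- With `lift_cls`, this makes `cls` and `lift` mutually inverse: as `J² = 0`, the conormal sheaf
is `J` itself. -/
lemma cls_lift (hμ : IsSquareZero μ) (U : X.Opens) (n : Γ(conormal μ, U)) :
    cls μ (φ.hom ⁻¹ᵁ U) (appTo φ.hom (φ.lift hμ) U n) =
      res (conormal μ) (φ.preimage_preimage U).le n := by
  have : φ.lift hμ ≫ (Scheme.Modules.pushforward φ.hom).map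
      ((Scheme.Modules.pullbackPushforwardAdjunction μ).unit.app (ideal μ)) =
      (φ.pushforwardIso (conormal μ)).inv := by
    -- Sections of the conormal sheaf need not be given as classes, but a morphism out of it is
    -- determined on classes.
    refine conormal_hom_ext fun V j ↦ ?_
    change cls μ (φ.hom ⁻¹ᵁ μ ⁻¹ᵁ V) (appTo φ.hom (φ.lift hμ) (μ ⁻¹ᵁ V)
      (cls μ V j)) = res (conormal μ) (φ.preimage_preimage _).le (cls μ V j)
    rw [lift_cls, cls_res]
  exact congr($(this).app U n)

lemma cls_injective (φ : Retraction μ f h) (hμ : IsSquareZero μ) (V : Z.Opens) :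
    Function.Injective (cls μ V) := fun j j' e ↦ by
  have := congr(appTo φ.hom (φ.lift hμ) (μ ⁻¹ᵁ V) $e)
  rw [lift_cls, lift_cls] at this
  exact res_injective _ _ (φ.preimage_preimage' hμ V).ge this

/-- The section `r - φ^♯ μ^♯ r` of the ideal of `μ`. -/
def idealPart (hμ : IsSquareZero μ) (V : Z.Opens) (r : Γ(Z, V)) : Γ(ideal μ, V) :=
  idealMk μ V (r - fres (φ.preimage_preimage' hμ V).ge (φ.hom.app _ (μ.app V r))) (by
    rw [map_sub, fres_app, app_app, fres_fres, fres_self, sub_self])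

lemma idealVal_idealPart (hμ : IsSquareZero μ) (V : Z.Opens) (r : Γ(Z, V)) :
    idealVal μ V (φ.idealPart hμ V r) =
      r - fres (φ.preimage_preimage' hμ V).ge (φ.hom.app _ (μ.app V r)) :=
  idealVal_idealMk _ _ _ _

/-- The class of `r - φ^♯ μ^♯ r` in the conormal sheaf of `μ`. -/
def delta (hμ : IsSquareZero μ) (V : Z.Opens) (r : Γ(Z, V)) : Γ(conormal μ, μ ⁻¹ᵁ V) :=
  cls μ V (φ.idealPart hμ V r)

lemma delta_add (hμ : IsSquareZero μ) (V : Z.Opens) (r s : Γ(Z, V)) :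
    φ.delta hμ V (r + s) = φ.delta hμ V r + φ.delta hμ V s := by
  rw [delta, delta, delta, ← map_add]
  congr 1
  apply idealVal_injective
  simp only [idealVal_add, idealVal_idealPart, map_add]
  ring

/-- The Leibniz rule, from `rs - φ(rs) = r (s - φ s) + φ s (r - φ r)`, where `φ` abbreviates `φ^♯
μ^♯`. -/
lemma delta_mul (hμ : IsSquareZero μ) (V : Z.Opens) (r s : Γ(Z, V)) :
    φ.delta hμ V (r * s) = μ.app V r • φ.delta hμ V s + μ.app V s • φ.delta hμ V r := by
  -- Lifting the second coefficient to `φ^♯ μ^♯ s` instead of `s` makes the identity hold on the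
  -- nose in `𝒪_Z`.
  have h1 : μ.app V s =
      μ.app V (fres (φ.preimage_preimage' hμ V).ge (φ.hom.app _ (μ.app V s))) := by
    rw [fres_app, app_app, fres_fres, fres_self]
  rw [h1, delta, delta, delta]
  rw [← cls_smul, ← cls_smul, ← map_add]
  congr 1
  apply idealVal_injective
  simp only [idealVal_add, idealVal_smul, idealVal_idealPart, map_mul]
  ring

lemma delta_app (hμ : IsSquareZero μ) (U : X.Opens) (s : Γ(X, U)) :
    φ.delta hμ _ (φ.hom.app U s) = 0 := by
  rw [delta, ← map_zero (cls μ (φ.hom ⁻¹ᵁ U))]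
  congr 1
  apply idealVal_injective
  rw [idealVal_idealPart, app_app, fres_app, fres_fres, fres_self, sub_self]
  exact (map_zero ((idealι μ).app (φ.hom ⁻¹ᵁ U)).hom).symm

lemma delta_one (hμ : IsSquareZero μ) (V : Z.Opens) : φ.delta hμ V 1 = 0 := by
  rw [delta, ← map_zero (cls μ V)]
  congr 1
  apply idealVal_injective
  rw [idealVal_idealPart, map_one, map_one, map_one, sub_self]
  exact (map_zero ((idealι μ).app V).hom).symm

lemma idealPart_res (hμ : IsSquareZero μ) {U V : Z.Opens} (hUV : U ≤ V) (r : Γ(Z, V)) :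
    φ.idealPart hμ U (fres hUV r) = res _ hUV (φ.idealPart hμ V r) := by
  apply idealVal_injective
  rw [idealVal_res, idealVal_idealPart, idealVal_idealPart, map_sub, fres_app, fres_app,
    fres_fres, fres_fres]

lemma delta_res (hμ : IsSquareZero μ) {U V : Z.Opens} (hUV : U ≤ V) (r : Γ(Z, V)) :
    φ.delta hμ U (fres hUV r) = res _ (μ.preimage_mono hUV) (φ.delta hμ V r) := by
  rw [delta, idealPart_res, cls_res]
  rfl

end Retraction

end

section

variable {X Y Z B : Scheme.{u}}

/-! ## The square zero extension of a module -/

/-- A sheaf of modules, from a sheaf of abelian groups with compatible module structures on its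
sections. -/
def modulesMk (F : TopCat.Presheaf Ab.{u} X) (hF : F.IsSheaf)
    (inst : ∀ U : X.Opens, Module Γ(X, U) (F.obj (.op U)))
    (map_smul : ∀ (U V : X.Opens) (h : U ⟶ V) (r : Γ(X, V)) (m : F.obj (.op V)),
      F.map h.op (r • m) = X.presheaf.map h.op r • F.map h.op m) : X.Modules where
  val := letI (U : X.Opensᵒᵖ) : Module (X.ringCatSheaf.obj.obj U) (F.obj U) := inst U.unop
    PresheafOfModules.ofPresheaf F (R := X.ringCatSheaf.obj)
      (fun U V h r m ↦ map_smul V.unop U.unop h.unop r m)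
  isSheaf := hF

namespace Retraction

variable {μ : X ⟶ Z} {f : X ⟶ B} {h : Z ⟶ B} (φ : Retraction μ f h) (hμ : IsSquareZero μ)
  (E : X.Modules)

/-- The sheaf of abelian groups underlying `squareZero`. -/
abbrev directSum (μ : X ⟶ Z) (E : X.Modules) : Z.Modules :=
  (Scheme.Modules.pushforward μ).obj E ⊞ (Scheme.Modules.pushforward μ).obj (tensor E (conormal μ))

section

variable {E} (V : Z.Opens)

/-- The first component of a section of `directSum`. -/
def fstSec : Γ(directSum μ E, V) →+ Γ(E, μ ⁻¹ᵁ V) :=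
  ((biprod.fst : directSum μ E ⟶ _).app V).hom

/-- The second component of a section of `directSum`. -/
def sndSec : Γ(directSum μ E, V) →+ Γ(tensor E (conormal μ), μ ⁻¹ᵁ V) :=
  ((biprod.snd : directSum μ E ⟶ _).app V).hom

/-- The inclusion of the first summand. -/
def inlSec : Γ(E, μ ⁻¹ᵁ V) →+ Γ(directSum μ E, V) :=
  ((biprod.inl : _ ⟶ directSum μ E).app V).hom

/-- The inclusion of the second summand. -/
def inrSec : Γ(tensor E (conormal μ), μ ⁻¹ᵁ V) →+ Γ(directSum μ E, V) :=
  ((biprod.inr : _ ⟶ directSum μ E).app V).hom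

variable {V}

@[simp] lemma fstSec_inlSec (e : Γ(E, μ ⁻¹ᵁ V)) : fstSec V (inlSec V e) = e :=
  congr(Scheme.Modules.Hom.app $(biprod.inl_fst (X := (Scheme.Modules.pushforward μ).obj E)
    (Y := (Scheme.Modules.pushforward μ).obj (tensor E (conormal μ)))) V e)

@[simp] lemma fstSec_inrSec (w : Γ(tensor E (conormal μ), μ ⁻¹ᵁ V)) :
    fstSec V (inrSec V w) = 0 :=
  congr(Scheme.Modules.Hom.app $(biprod.inr_fst (X := (Scheme.Modules.pushforward μ).obj E)
    (Y := (Scheme.Modules.pushforward μ).obj (tensor E (conormal μ)))) V w)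

@[simp] lemma sndSec_inlSec (e : Γ(E, μ ⁻¹ᵁ V)) : sndSec V (inlSec V e) = 0 :=
  congr(Scheme.Modules.Hom.app $(biprod.inl_snd (X := (Scheme.Modules.pushforward μ).obj E)
    (Y := (Scheme.Modules.pushforward μ).obj (tensor E (conormal μ)))) V e)

@[simp] lemma sndSec_inrSec (w : Γ(tensor E (conormal μ), μ ⁻¹ᵁ V)) :
    sndSec V (inrSec V w) = w :=
  congr(Scheme.Modules.Hom.app $(biprod.inr_snd (X := (Scheme.Modules.pushforward μ).obj E)
    (Y := (Scheme.Modules.pushforward μ).obj (tensor E (conormal μ)))) V w)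

lemma inlSec_add_inrSec (x : Γ(directSum μ E, V)) :
    inlSec V (fstSec V x) + inrSec V (sndSec V x) = x :=
  congr(Scheme.Modules.Hom.app $(biprod.total (X := (Scheme.Modules.pushforward μ).obj E)
    (Y := (Scheme.Modules.pushforward μ).obj (tensor E (conormal μ)))) V x)

lemma directSum_ext {x y : Γ(directSum μ E, V)} (h₁ : fstSec V x = fstSec V y)
    (h₂ : sndSec V x = sndSec V y) : x = y := by
  rw [← inlSec_add_inrSec x, ← inlSec_add_inrSec y, h₁, h₂]

lemma fstSec_smul (r : Γ(Z, V)) (x : Γ(directSum μ E, V)) :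
    fstSec V (r • x) = μ.app V r • fstSec V x :=
  (biprod.fst : directSum μ E ⟶ _).app_smul r x

lemma sndSec_smul (r : Γ(Z, V)) (x : Γ(directSum μ E, V)) :
    sndSec V (r • x) = μ.app V r • sndSec V x :=
  (biprod.snd : directSum μ E ⟶ _).app_smul r x

lemma fstSec_res {U V : Z.Opens} (hUV : U ≤ V) (x : Γ(directSum μ E, V)) :
    fstSec U (res _ hUV x) = res E (μ.preimage_mono hUV) (fstSec V x) :=
  app_res (biprod.fst : directSum μ E ⟶ _) hUV x

lemma sndSec_res {U V : Z.Opens} (hUV : U ≤ V) (x : Γ(directSum μ E, V)) :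
    sndSec U (res _ hUV x) = res _ (μ.preimage_mono hUV) (sndSec V x) :=
  app_res (biprod.snd : directSum μ E ⟶ _) hUV x

lemma inlSec_res {U V : Z.Opens} (hUV : U ≤ V) (e : Γ(E, μ ⁻¹ᵁ V)) :
    inlSec U (res E (μ.preimage_mono hUV) e) = res _ hUV (inlSec V e) :=
  app_res (biprod.inl : _ ⟶ directSum μ E) hUV e

/-- The twisted scalar multiplication `r (e, w) = (r e, r w + e ⊗ δ r)`. -/
def twist (r : Γ(Z, V)) (x : Γ(directSum μ E, V)) : Γ(directSum μ E, V) :=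
  r • x + inrSec V (tmul E (conormal μ) _ (fstSec V x) (φ.delta hμ V r))

lemma fstSec_twist (r : Γ(Z, V)) (x : Γ(directSum μ E, V)) :
    fstSec V (φ.twist hμ r x) = μ.app V r • fstSec V x := by
  rw [twist, map_add, fstSec_smul, fstSec_inrSec, add_zero]

lemma sndSec_twist (r : Γ(Z, V)) (x : Γ(directSum μ E, V)) :
    sndSec V (φ.twist hμ r x) = μ.app V r • sndSec V x +
      tmul E (conormal μ) _ (fstSec V x) (φ.delta hμ V r) := by
  rw [twist, map_add, sndSec_smul, sndSec_inrSec]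

lemma delta_zero : φ.delta hμ V 0 = 0 := by
  have := φ.delta_add hμ V 0 0
  rwa [add_zero, left_eq_add] at this

/-- The twisted module structure. -/
@[reducible] def twistModule (V : Z.Opens) : Module Γ(Z, V) Γ(directSum μ E, V) where
  smul r x := φ.twist hμ r x
  one_smul x := directSum_ext
    ((φ.fstSec_twist hμ 1 x).trans (by rw [map_one, one_smul]))
    ((φ.sndSec_twist hμ 1 x).trans (by rw [map_one, one_smul, delta_one, map_zero, add_zero]))
  -- Associativity in the second component is the Leibniz rule for `δ`.
  mul_smul r s x := directSum_ext
    ((φ.fstSec_twist hμ (r * s) x).trans (by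
      refine Eq.trans ?_ (φ.fstSec_twist hμ r (φ.twist hμ s x)).symm
      rw [fstSec_twist, map_mul, mul_smul]))
    ((φ.sndSec_twist hμ (r * s) x).trans (by
      refine Eq.trans ?_ (φ.sndSec_twist hμ r (φ.twist hμ s x)).symm
      rw [fstSec_twist, sndSec_twist, map_mul, mul_smul, delta_mul, map_add, map_smul, map_smul,
        map_smul, LinearMap.smul_apply, smul_add, add_assoc]))
  smul_zero r := directSum_ext
    ((φ.fstSec_twist hμ r 0).trans (by rw [map_zero, smul_zero]))
    ((φ.sndSec_twist hμ r 0).trans (by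
      rw [map_zero, map_zero, smul_zero, map_zero, LinearMap.zero_apply, add_zero]))
  smul_add r x y := directSum_ext
    ((φ.fstSec_twist hμ r (x + y)).trans (by
      refine Eq.trans ?_ (map_add (fstSec V) (φ.twist hμ r x) (φ.twist hμ r y)).symm
      rw [fstSec_twist, fstSec_twist, map_add, smul_add]))
    ((φ.sndSec_twist hμ r (x + y)).trans (by
      refine Eq.trans ?_ (map_add (sndSec V) (φ.twist hμ r x) (φ.twist hμ r y)).symm
      rw [sndSec_twist, sndSec_twist, map_add, map_add, smul_add, map_add, LinearMap.add_apply,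
        add_add_add_comm]))
  add_smul r s x := directSum_ext
    ((φ.fstSec_twist hμ (r + s) x).trans (by
      refine Eq.trans ?_ (map_add (fstSec V) (φ.twist hμ r x) (φ.twist hμ s x)).symm
      rw [fstSec_twist, fstSec_twist, map_add, add_smul]))
    ((φ.sndSec_twist hμ (r + s) x).trans (by
      refine Eq.trans ?_ (map_add (sndSec V) (φ.twist hμ r x) (φ.twist hμ s x)).symm
      rw [sndSec_twist, sndSec_twist, map_add, add_smul, delta_add, map_add,
        add_add_add_comm]))
  zero_smul x := directSum_ext
    ((φ.fstSec_twist hμ 0 x).trans (by rw [map_zero, zero_smul, map_zero]))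
    ((φ.sndSec_twist hμ 0 x).trans (by
      rw [map_zero, zero_smul, delta_zero, map_zero, add_zero, map_zero]))

lemma res_twist {U V : Z.Opens} (hUV : U ≤ V) (r : Γ(Z, V)) (x : Γ(directSum μ E, V)) :
    res _ hUV (φ.twist hμ r x) = φ.twist hμ (fres hUV r) (res _ hUV x) :=
  directSum_ext
    (by rw [fstSec_res, fstSec_twist, fstSec_twist, fres_app, fstSec_res, res_smul])
    (by rw [sndSec_res, sndSec_twist, sndSec_twist, fres_app, fstSec_res, sndSec_res, delta_res,
      map_add, res_smul, res_tmul])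

end

/-- The `𝒪_Z`-module `E ⊕ E ⊗ (J / J²)`, with `r (e, w) = (r e, r w + e ⊗ [r - φ^♯ μ^♯ r])`. -/
def squareZero : Z.Modules :=
  modulesMk (directSum μ E).presheaf (directSum μ E).isSheaf (φ.twistModule hμ)
    (fun _ _ h r x ↦ φ.res_twist hμ (leOfHom h) r x)

/-- The morphism `φ^* E ⟶ squareZero`, `φ^* e ↦ (e, 0)`. -/
def toSquareZero : (Scheme.Modules.pullback φ.hom).obj E ⟶ φ.squareZero hμ E :=
  pullDesc φ.hom (homMk (N := (Scheme.Modules.pushforward φ.hom).obj (φ.squareZero hμ E))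
    (fun U ↦
      { toFun := fun e ↦ (inlSec (φ.hom ⁻¹ᵁ U) (res E (φ.preimage_preimage U).le e) :
          Γ(directSum μ E, φ.hom ⁻¹ᵁ U))
        map_add' := fun e e' ↦ by rw [map_add, map_add]; rfl
        map_smul' := fun s e ↦ by
          change _ = φ.twist hμ (φ.hom.app U s) _
          refine directSum_ext ?_ ?_
          · rw [fstSec_twist, fstSec_inlSec, fstSec_inlSec, app_app, res_smul]
          -- Linearity over `𝒪_X` holds because `δ` kills `φ^♯ s`.
          · rw [sndSec_twist, sndSec_inlSec, sndSec_inlSec, delta_app, map_zero, smul_zero,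
              add_zero] })
    (fun U V hUV e ↦ by
      change inlSec (φ.hom ⁻¹ᵁ U) _ = res (directSum μ E) (φ.hom.preimage_mono hUV) (inlSec _ _)
      rw [← inlSec_res, res_res, res_res]))

end Retraction

end

/-! ### Decomposition of `φ^* E`, exactness of the extension and the projection formula -/

section

variable {X Y Z B : Scheme.{u}}

/-- Stated for families of additive maps because `toSum` respects the twisted scalars and not those
of `directSum`. -/
lemma tensor_addHom_ext {M N P : X.Modules} {a b : ∀ U : X.Opens, Γ(tensor M N, U) →+ Γ(P, U)}
    (ha : ∀ ⦃U V : X.Opens⦄ (h : U ≤ V) t, a U (res _ h t) = res P h (a V t))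
    (hb : ∀ ⦃U V : X.Opens⦄ (h : U ≤ V) t, b U (res _ h t) = res P h (b V t))
    (hab : ∀ U m n, a U (tmul M N U m n) = b U (tmul M N U m n)) (U : X.Opens)
    (t : Γ(tensor M N, U)) : a U t = b U t := by
  refine tensor_induction M N (Q := fun U t ↦ a U t = b U t) ?_ ?_ ?_ hab U t
  · intro U t loc
    refine section_ext fun x hx ↦ ?_
    obtain ⟨V, hV, hxV, e⟩ := loc x hx
    exact ⟨V, hV, hxV, by rw [← ha, ← hb, e]⟩
  · intro U
    rw [map_zero, map_zero]
  · intro U t t' h h'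
    rw [map_add, map_add, h, h']

/-- `(J M) ⊗ J` dies in `M ⊗ J`, since `i m ⊗ j = m ⊗ i j` and `i j = 0`. -/
lemma IsSquareZero.tmul_idealAction {μ : X ⟶ Z} (hμ : IsSquareZero μ) (M : Z.Modules)
    (V : Z.Opens) (t : Γ(tensor M (ideal μ), V)) (j : Γ(ideal μ, V)) :
    tmul M (ideal μ) V ((idealAction μ M).app V t) j = 0 := by
  refine tensor_induction M (ideal μ) (Q := fun V t ↦ ∀ j : Γ(ideal μ, V),
    tmul M (ideal μ) V ((idealAction μ M).app V t) j = 0) ?_ ?_ ?_ ?_ V t j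
  · intro U t loc j
    refine section_ext fun x hx ↦ ?_
    obtain ⟨V, hV, hxV, e⟩ := loc x hx
    refine ⟨V, hV, hxV, ?_⟩
    rw [res_tmul, ← app_res, e, map_zero]
  · intro U j
    rw [map_zero, map_zero, LinearMap.zero_apply]
  · intro U t t' ht ht' j
    rw [map_add, map_add, LinearMap.add_apply, ht, ht', add_zero]
  · intro U m i j
    have : idealVal μ U i • j = 0 := by
      rw [hμ.smul_congr U _ 0 (by rw [app_idealVal, map_zero]), zero_smul]
    rw [idealAction_tmul, LinearMap.map_smul₂, ← map_smul, this, map_zero]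

namespace Retraction

variable {μ : X ⟶ Z} {f : X ⟶ B} {h : Z ⟶ B} (φ : Retraction μ f h) (hμ : IsSquareZero μ)
  (E : X.Modules)

/-- The components of a section of `φ^* E`. -/
def toSum (V : Z.Opens) :
    Γ((Scheme.Modules.pullback φ.hom).obj E, V) →+ Γ(directSum μ E, V) :=
  ((φ.toSquareZero hμ E).app V).hom

lemma toSum_pull (U : X.Opens) (e : Γ(E, U)) :
    φ.toSum hμ E _ (pull φ.hom E U e) = inlSec _ (res E (φ.preimage_preimage U).le e) :=
  pullDesc_pull φ.hom _ U e

lemma toSum_res {U V : Z.Opens} (hUV : U ≤ V)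
    (m : Γ((Scheme.Modules.pullback φ.hom).obj E, V)) :
    φ.toSum hμ E U (res _ hUV m) = res _ hUV (φ.toSum hμ E V m) :=
  app_res (φ.toSquareZero hμ E) hUV m

lemma toSum_smul (V : Z.Opens) (r : Γ(Z, V)) (m : Γ((Scheme.Modules.pullback φ.hom).obj E, V)) :
    φ.toSum hμ E V (r • m) = φ.twist hμ r (φ.toSum hμ E V m) :=
  (φ.toSquareZero hμ E).app_smul r m

/-- The projection of `squareZero` to its first component. -/
def squareZeroFst : φ.squareZero hμ E ⟶ (Scheme.Modules.pushforward μ).obj E :=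
  homMk (fun V ↦
    { toFun := fun (x : Γ(directSum μ E, V)) ↦ (fstSec V x : Γ(E, μ ⁻¹ᵁ V))
      map_add' := fun x y ↦ map_add (fstSec V) x y
      map_smul' := fun r x ↦ φ.fstSec_twist hμ r x })
    (fun _ _ hUV x ↦ fstSec_res hUV x)

/-- Both sides are values of morphisms out of `φ^* E`, and both send `φ^* e` to `e`. -/
lemma fstSec_toSum (V : Z.Opens) (m : Γ((Scheme.Modules.pullback φ.hom).obj E, V)) :
    fstSec V (φ.toSum hμ E V m) = appTo μ (φ.quo E) V m := by
  have : φ.toSquareZero hμ E ≫ φ.squareZeroFst hμ E = φ.quo E := by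
    refine pullback_hom_ext fun U e ↦ ?_
    refine Eq.trans ?_ (φ.quo_pull E U e).symm
    change fstSec _ (φ.toSum hμ E _ (pull φ.hom E U e)) = _
    rw [toSum_pull, fstSec_inlSec]
  exact congr($(this).app V m)

/-- The morphism `E ⊗ J / J² ⟶ φ_* (φ^* E ⊗ J)`, `e ⊗ n ↦ φ^* e ⊗ n`. -/
def projInv : tensor E (conormal μ) ⟶ (Scheme.Modules.pushforward φ.hom).obj
    (tensor ((Scheme.Modules.pullback φ.hom).obj E) (ideal μ)) :=
  tensorMap ((Scheme.Modules.pullbackPushforwardAdjunction φ.hom).unit.app E) (φ.lift hμ) ≫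
    pushforwardTensor φ.hom _ _

lemma projInv_tmul (U : X.Opens) (e : Γ(E, U)) (n : Γ(conormal μ, U)) :
    appTo φ.hom (φ.projInv hμ E) U (tmul _ _ U e n) =
      tmul _ _ (φ.hom ⁻¹ᵁ U) (pull φ.hom E U e) (appTo φ.hom (φ.lift hμ) U n) := by
  have h1 := tensorMap_tmul ((Scheme.Modules.pullbackPushforwardAdjunction φ.hom).unit.app E)
    (φ.lift hμ) U e n
  have h2 := pushforwardTensor_tmul φ.hom ((Scheme.Modules.pullback φ.hom).obj E) (ideal μ) U
    (pull φ.hom E U e) (appTo φ.hom (φ.lift hμ) U n)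
  exact congr((pushforwardTensor φ.hom _ _).app U $h1).trans h2

/-- The map `projInv`, on sections over an open subset of `Z`. -/
def projInvSec (V : Z.Opens) : Γ(tensor E (conormal μ), μ ⁻¹ᵁ V) →+
    Γ(tensor ((Scheme.Modules.pullback φ.hom).obj E) (ideal μ), V) :=
  (res _ (φ.preimage_preimage' hμ V).ge).comp (appTo φ.hom (φ.projInv hμ E) (μ ⁻¹ᵁ V))

lemma projInvSec_apply (V : Z.Opens) (w : Γ(tensor E (conormal μ), μ ⁻¹ᵁ V)) :
    φ.projInvSec hμ E V w = res _ (φ.preimage_preimage' hμ V).ge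
      (appTo φ.hom (φ.projInv hμ E) (μ ⁻¹ᵁ V) w) := rfl

lemma projInvSec_res {U V : Z.Opens} (hUV : U ≤ V) (w : Γ(tensor E (conormal μ), μ ⁻¹ᵁ V)) :
    φ.projInvSec hμ E U (res _ (μ.preimage_mono hUV) w) = res _ hUV (φ.projInvSec hμ E V w) := by
  rw [projInvSec_apply, projInvSec_apply, appTo_res, res_res, res_res]

/-- Pullback along `φ`, for sections over an open subset of `Z`. -/
def pullSec (V : Z.Opens) :
    Γ(E, μ ⁻¹ᵁ V) →+ Γ((Scheme.Modules.pullback φ.hom).obj E, V) :=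
  (res _ (φ.preimage_preimage' hμ V).ge).comp (pull φ.hom E (μ ⁻¹ᵁ V))

lemma pullSec_apply (V : Z.Opens) (e : Γ(E, μ ⁻¹ᵁ V)) :
    φ.pullSec hμ E V e = res _ (φ.preimage_preimage' hμ V).ge (pull φ.hom E (μ ⁻¹ᵁ V) e) := rfl

lemma pullSec_res {U V : Z.Opens} (hUV : U ≤ V) (e : Γ(E, μ ⁻¹ᵁ V)) :
    φ.pullSec hμ E U (res _ (μ.preimage_mono hUV) e) = res _ hUV (φ.pullSec hμ E V e) := by
  rw [pullSec_apply, pullSec_apply, pull_res, res_res, res_res]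

lemma projInvSec_tmul (V : Z.Opens) (e : Γ(E, μ ⁻¹ᵁ V)) (j : Γ(ideal μ, V)) :
    φ.projInvSec hμ E V (tmul _ _ _ e (cls μ V j)) = tmul _ _ V (φ.pullSec hμ E V e) j := by
  rw [projInvSec_apply, projInv_tmul, res_tmul, lift_cls, res_res, res_self, pullSec_apply]

lemma quo_pullSec (V : Z.Opens) (e : Γ(E, μ ⁻¹ᵁ V)) :
    appTo μ (φ.quo E) V (φ.pullSec hμ E V e) = e := by
  rw [pullSec_apply]
  refine (appTo_res μ (φ.quo E) _ _).trans ?_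
  refine (congrArg (res E _) (φ.quo_pull E _ e)).trans ?_
  rw [res_res, res_self]

lemma pullSec_smul (V : Z.Opens) (r : Γ(Z, V)) (e : Γ(E, μ ⁻¹ᵁ V)) :
    φ.pullSec hμ E V (μ.app V r • e) =
      fres (φ.preimage_preimage' hμ V).ge (φ.hom.app _ (μ.app V r)) • φ.pullSec hμ E V e := by
  rw [pullSec_apply, pullSec_apply, pull_smul, res_smul]

lemma projInvSec_smul (V : Z.Opens) (r : Γ(Z, V)) (w : Γ(tensor E (conormal μ), μ ⁻¹ᵁ V)) :
    φ.projInvSec hμ E V (μ.app V r • w) =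
      fres (φ.preimage_preimage' hμ V).ge (φ.hom.app _ (μ.app V r)) • φ.projInvSec hμ E V w := by
  rw [projInvSec_apply, projInvSec_apply, appTo_smul, res_smul]

/-- The map underlying `ofSquareZero`. -/
def ofSum (V : Z.Opens) : Γ(directSum μ E, V) →+ Γ((Scheme.Modules.pullback φ.hom).obj E, V) :=
  (φ.pullSec hμ E V).comp (fstSec V) + ((idealAction μ _).app V).hom.comp
    ((φ.projInvSec hμ E V).comp (sndSec V))

lemma ofSum_apply (V : Z.Opens) (x : Γ(directSum μ E, V)) :
    φ.ofSum hμ E V x = φ.pullSec hμ E V (fstSec V x) +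
      (idealAction μ _).app V (φ.projInvSec hμ E V (sndSec V x)) := rfl

lemma ofSum_res {U V : Z.Opens} (hUV : U ≤ V) (x : Γ(directSum μ E, V)) :
    φ.ofSum hμ E U (res _ hUV x) = res _ hUV (φ.ofSum hμ E V x) := by
  rw [ofSum_apply, ofSum_apply, fstSec_res, sndSec_res, pullSec_res, projInvSec_res, app_res,
    map_add]

/-- Write `r = φ^♯ μ^♯ r + (r - φ^♯ μ^♯ r)`. Applied to `φ^* e`, the second summand is the image of
`φ^* e ⊗ (r - φ^♯ μ^♯ r)`, which is what the twisting term `e ⊗ δ r` is sent to. -/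
lemma ofSum_twist (V : Z.Opens) (r : Γ(Z, V)) (x : Γ(directSum μ E, V)) :
    φ.ofSum hμ E V (φ.twist hμ r x) = r • φ.ofSum hμ E V x := by
  -- On the image of `φ^* E ⊗ J` the scalars `r` and `φ^♯ μ^♯ r` agree, their difference being in
  -- `J`.
  have := hμ.smul_idealAction _ V (r - fres (φ.preimage_preimage' hμ V).ge
    (φ.hom.app _ (μ.app V r))) (by
      rw [map_sub, fres_app, app_app, fres_fres, fres_self, sub_self])
    (φ.projInvSec hμ E V (sndSec V x))
  rw [sub_smul, sub_eq_zero] at this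
  rw [ofSum_apply, ofSum_apply, fstSec_twist, sndSec_twist, pullSec_smul, map_add,
    projInvSec_smul, delta, projInvSec_tmul, map_add, Scheme.Modules.Hom.app_smul,
    idealAction_tmul, idealVal_idealPart, smul_add, sub_smul, ← this]
  abel

/-- The inverse of `toSquareZero`. -/
def ofSquareZero : φ.squareZero hμ E ⟶ (Scheme.Modules.pullback φ.hom).obj E :=
  homMk (fun V ↦
    { toFun := fun x ↦ φ.ofSum hμ E V x
      map_add' := fun x y ↦ map_add (φ.ofSum hμ E V) x y
      map_smul' := fun r x ↦ φ.ofSum_twist hμ E V r x })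
    (fun _ _ hUV x ↦ φ.ofSum_res hμ E hUV x)

/-- Every section of `φ^* E` is the pullback of its restriction to `X` plus a section coming from
`φ^* E ⊗ J`. The composite of `toSquareZero` and `ofSquareZero` is linear over `𝒪_Z`, so it suffices
to check it on `φ^* e`. -/
lemma pullSec_add_idealAction (V : Z.Opens) (m : Γ((Scheme.Modules.pullback φ.hom).obj E, V)) :
    φ.pullSec hμ E V (appTo μ (φ.quo E) V m) + (idealAction μ _).app V
      (φ.projInvSec hμ E V (sndSec V (φ.toSum hμ E V m))) = m := by
  have : φ.toSquareZero hμ E ≫ φ.ofSquareZero hμ E = 𝟙 _ := by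
    refine pullback_hom_ext fun U e ↦ ?_
    change φ.ofSum hμ E _ (φ.toSum hμ E _ (pull φ.hom E U e)) = pull φ.hom E U e
    rw [ofSum_apply, toSum_pull, fstSec_inlSec, sndSec_inlSec, map_zero, map_zero, add_zero,
      pullSec_apply, pull_res, res_res, res_self]
  rw [← fstSec_toSum φ hμ]
  exact congr($(this).app V m)

/-- On `j m` the untwisted terms carry the factor `μ^♯ j = 0`; what remains is `m|_X ⊗ δ j`, and `δ
j = [j]`. Injectivity of `φ^* E ⊗ J ⟶ φ^* E` comes from here. -/
lemma toSum_idealAction (V : Z.Opens)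
    (t : Γ(tensor ((Scheme.Modules.pullback φ.hom).obj E) (ideal μ), V)) :
    φ.toSum hμ E V ((idealAction μ _).app V t) = inrSec V (appTo μ (φ.proj E) V t) := by
  refine tensor_addHom_ext (P := directSum μ E)
    (a := fun V ↦ (φ.toSum hμ E V).comp ((idealAction μ _).app V).hom)
    (b := fun V ↦ (inrSec V).comp (appTo μ (φ.proj E) V))
    (fun U V hUV t ↦ ?_) (fun U V hUV t ↦ ?_) (fun U m j ↦ ?_) V t
  · change φ.toSum hμ E U ((idealAction μ _).app U (res _ _ t)) =
      res _ _ (φ.toSum hμ E V ((idealAction μ _).app V t))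
    rw [app_res, toSum_res]
  · exact app_res (φ.proj E ≫ (biprod.inr : _ ⟶ directSum μ E)) hUV t
  · change φ.toSum hμ E U ((idealAction μ _).app U _) = inrSec U (appTo μ (φ.proj E) U _)
    have hj : μ.app U (idealVal μ U j) = 0 := app_idealVal μ U j
    rw [proj_tmul, idealAction_tmul, toSum_smul]
    refine directSum_ext ?_ ?_
    · rw [fstSec_twist, hj, zero_smul, fstSec_inrSec]
    · rw [sndSec_twist, hj, zero_smul, zero_add, sndSec_inrSec, fstSec_toSum]
      refine congrArg _ ?_
      refine congrArg (cls μ U) (idealVal_injective μ U ?_)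
      rw [idealVal_idealPart, hj, map_zero, map_zero, sub_zero]

/-- A tensor `m ⊗ j` goes to `m|_X ⊗ [j]` and back to `φ^*(m|_X) ⊗ j`. The error lies in `(J φ^* E)
⊗ J`, whose image in `φ^* E ⊗ J` is zero by `tmul_idealAction`. -/
lemma projInvSec_proj (V : Z.Opens)
    (t : Γ(tensor ((Scheme.Modules.pullback φ.hom).obj E) (ideal μ), V)) :
    φ.projInvSec hμ E V (appTo μ (φ.proj E) V t) = t := by
  refine tensor_addHom_ext
    (a := fun V ↦ (φ.projInvSec hμ E V).comp (appTo μ (φ.proj E) V))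
    (b := fun V ↦ AddMonoidHom.id _)
    (fun U V hUV t ↦ ?_) (fun _ _ _ _ ↦ rfl) (fun U m j ↦ ?_) V t
  · change φ.projInvSec hμ E U (appTo μ (φ.proj E) U (res _ _ t)) =
      res _ _ (φ.projInvSec hμ E V (appTo μ (φ.proj E) V t))
    rw [appTo_res]
    exact φ.projInvSec_res hμ E hUV _
  · change φ.projInvSec hμ E U (appTo μ (φ.proj E) U _) = tmul _ _ U m j
    rw [proj_tmul]
    refine (φ.projInvSec_tmul hμ E U _ j).trans ?_
    conv_rhs => rw [← φ.pullSec_add_idealAction hμ E U m]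
    rw [map_add, LinearMap.add_apply, hμ.tmul_idealAction, add_zero]

lemma proj_injective (hμ : IsSquareZero μ) (V : Z.Opens) :
    Function.Injective (appTo μ (φ.proj E) V) :=
  Function.LeftInverse.injective (φ.projInvSec_proj hμ E V)

lemma proj_surjective (hμ : IsSquareZero μ) (V : Z.Opens) :
    Function.Surjective (appTo μ (φ.proj E) V) := fun w ↦ by
  -- The other composite only has to be checked on `e ⊗ n`, where it reduces to `quo_pull` and
  -- `cls_lift`.
  have : φ.projInv hμ E ≫ (Scheme.Modules.pushforward φ.hom).map (φ.proj E) =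
      (φ.pushforwardIso _).inv := by
    refine tensor_hom_ext fun U e n ↦ ?_
    refine (congrArg (appTo μ (φ.proj E) (φ.hom ⁻¹ᵁ U)) (φ.projInv_tmul hμ E U e n)).trans ?_
    refine (φ.proj_tmul E _ _ _).trans ?_
    refine Eq.trans ?_ (res_tmul E (conormal μ) (φ.preimage_preimage U).le e n).symm
    exact congr(tmul E (conormal μ) _ $(φ.quo_pull E U e) $(φ.cls_lift hμ U n))
  refine ⟨φ.projInvSec hμ E V w, ?_⟩
  rw [projInvSec_apply]
  refine (appTo_res μ (φ.proj E) _ _).trans ?_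
  refine (congrArg (res (tensor E (conormal μ)) _) congr($(this).app _ w)).trans ?_
  exact (res_res (tensor E (conormal μ)) _ _ w).trans (res_self _ _ _)

lemma idealAction_injective (hμ : IsSquareZero μ) (V : Z.Opens) : Function.Injective
    ((idealAction μ ((Scheme.Modules.pullback φ.hom).obj E)).app V) := by
  intro t t' e
  apply φ.proj_injective E hμ V
  have := congr(sndSec V (φ.toSum hμ E V $e))
  rwa [toSum_idealAction, toSum_idealAction, sndSec_inrSec, sndSec_inrSec] at this

theorem extension_shortExact (hμ : IsSquareZero μ) (φ₁ φ₂ : Retraction μ f h) (E : X.Modules) :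
    (extension φ₁ φ₂ E).ShortExact := by
  refine shortExact_of_sections _ (fun U ↦ φ₁.idealAction_injective E hμ _) (fun U e ↦ ?_)
    (fun U m hm ↦ ?_)
  -- A lift of `e` is `φ₁^* e`.
  · refine ⟨φ₁.pullSec hμ E (φ₂.hom ⁻¹ᵁ U) (res E (φ₂.preimage_preimage U).le e), ?_⟩
    refine (quotientMap_app φ₁ φ₂ E U _).trans ?_
    refine (congrArg _ (φ₁.quo_pullSec hμ E _ _)).trans ?_
    exact (res_res E _ _ e).trans (res_self E _ e)
  -- If `m` vanishes on `X`, only the `J` part of its decomposition survives.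
  · refine ⟨φ₁.projInvSec hμ E (φ₂.hom ⁻¹ᵁ U) (sndSec _ (φ₁.toSum hμ E (φ₂.hom ⁻¹ᵁ U) m)), ?_⟩
    refine Eq.trans ?_ (φ₁.pullSec_add_idealAction hμ E (φ₂.hom ⁻¹ᵁ U) m)
    have h0 : appTo μ (φ₁.quo E) (φ₂.hom ⁻¹ᵁ U) m = 0 := by
      apply res_injective _ (φ₂.preimage_preimage U).ge (φ₂.preimage_preimage U).le
      refine Eq.trans ?_ (map_zero (res E (φ₂.preimage_preimage U).ge)).symm
      exact (quotientMap_app φ₁ φ₂ E U m).symm.trans hm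
    rw [h0]
    refine Eq.trans ?_ (congrArg (· + _) (map_zero (φ₁.pullSec hμ E (φ₂.hom ⁻¹ᵁ U))).symm)
    exact (zero_add _).symm

theorem isIso_projectionFormula (hμ : IsSquareZero μ) (φ₁ φ₂ : Retraction μ f h) (E : X.Modules) :
    IsIso (projectionFormula φ₁ φ₂ E) := by
  refine isIso_of_bijective _ fun U ↦ ⟨fun t t' e ↦ ?_, fun w ↦ ?_⟩
  · apply φ₁.proj_injective E hμ
    apply res_injective _ (φ₂.preimage_preimage U).ge (φ₂.preimage_preimage U).le
    exact e
  · obtain ⟨t, ht⟩ := φ₁.proj_surjective E hμ (φ₂.hom ⁻¹ᵁ U)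
      (res _ (φ₂.preimage_preimage U).le w)
    refine ⟨t, (projectionFormula_app φ₁ φ₂ E U t).trans ?_⟩
    refine (congrArg (res (tensor E (conormal μ)) _) ht).trans ?_
    exact (res_res _ _ _ _).trans (res_self _ _ _)

end Retraction

end

/-! ### Functions on thickenings and the morphisms between thickenings -/

section

variable {X Y Z Z' B : Scheme.{u}}

lemma app_app_of_comp_eq {f : X ⟶ Y} {g : Y ⟶ Z} {e : X ⟶ Z} (h : f ≫ g = e) (V : Z.Opens)
    (r : Γ(Z, V)) :
    f.app (g ⁻¹ᵁ V) (g.app V r) = fres (by rw [← h]; rfl) (e.app V r) := by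
  subst h
  exact (fres_self (U := f ⁻¹ᵁ g ⁻¹ᵁ V) le_rfl _).symm

lemma hom_ext_of_app {f g : X ⟶ Y} (hb : f.base = g.base)
    (h : ∀ U s, f.app U s = fres (congr((TopologicalSpace.Opens.map $hb).obj U)).le (g.app U s)) :
    f = g := by
  refine Scheme.Hom.ext hb fun U ↦ ?_
  ext s
  refine (congrArg _ (h U s)).trans ?_
  exact (fres_fres (congr((TopologicalSpace.Opens.map $hb).obj U)).ge _ _).trans (fres_self _ _)

namespace Retraction

section

variable {μ : X ⟶ Z} {f : X ⟶ B} {h : Z ⟶ B} (φ : Retraction μ f h) (hμ : IsSquareZero μ)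

/-- The inclusion of `J / J²` into `φ_* 𝒪_Z`. -/
def liftVal (U : X.Opens) : Γ(conormal μ, U) →+ Γ(Z, φ.hom ⁻¹ᵁ U) where
  toFun n := idealVal μ _ (appTo φ.hom (φ.lift hμ) U n)
  map_zero' := by
    rw [map_zero]
    exact map_zero ((idealι μ).app _).hom
  map_add' n n' := by rw [map_add, idealVal_add]

lemma liftVal_apply (U : X.Opens) (n : Γ(conormal μ, U)) :
    φ.liftVal hμ U n = idealVal μ _ (appTo φ.hom (φ.lift hμ) U n) := rfl

lemma app_liftVal (U : X.Opens) (n : Γ(conormal μ, U)) : μ.app _ (φ.liftVal hμ U n) = 0 :=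
  app_idealVal _ _ _

lemma liftVal_mul_liftVal (U : X.Opens) (n n' : Γ(conormal μ, U)) :
    φ.liftVal hμ U n * φ.liftVal hμ U n' = 0 :=
  hμ.mul_eq_zero _ _ _ (app_idealVal _ _ _) (app_idealVal _ _ _)

lemma liftVal_smul (U : X.Opens) (s : Γ(X, U)) (n : Γ(conormal μ, U)) :
    φ.liftVal hμ U (s • n) = φ.hom.app U s * φ.liftVal hμ U n := by
  rw [liftVal_apply, liftVal_apply, appTo_smul, idealVal_smul]

lemma liftVal_res {U V : X.Opens} (hUV : U ≤ V) (n : Γ(conormal μ, V)) :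
    φ.liftVal hμ U (res _ hUV n) = fres (φ.hom.preimage_mono hUV) (φ.liftVal hμ V n) := by
  rw [liftVal_apply, liftVal_apply, appTo_res, idealVal_res]

end

/-! ### Morphisms of square zero thickenings from morphisms of conormal sheaves -/

section

variable {μ : X ⟶ Z} {f : X ⟶ B} {h : Z ⟶ B} (φ : Retraction μ f h) (hμ : IsSquareZero μ)
  {μ' : X ⟶ Z'} {h' : Z' ⟶ B} (π : Retraction μ' f h') (hμ' : IsSquareZero μ')
  (x : conormal μ' ⟶ conormal μ)

/-- The ring homomorphism `r ↦ φ^♯ μ'^♯ r + x [r - π^♯ μ'^♯ r]`. -/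
def thickenApp (V : Z'.Opens) : Γ(Z', V) →+* Γ(Z, φ.hom ⁻¹ᵁ μ' ⁻¹ᵁ V) where
  toFun r := φ.hom.app _ (μ'.app V r) +
    φ.liftVal hμ _ (x.app (μ' ⁻¹ᵁ V) (π.delta hμ' V r))
  map_one' := by
    rw [map_one, map_one, delta_one, map_zero, map_zero, add_zero]
  map_zero' := by
    rw [map_zero, map_zero, delta_zero, map_zero, map_zero, add_zero]
  map_add' r s := by
    rw [map_add, map_add, delta_add, map_add, map_add, add_add_add_comm]
  map_mul' r s := by
    rw [map_mul, map_mul, delta_mul, map_add, map_add, Scheme.Modules.Hom.app_smul,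
      Scheme.Modules.Hom.app_smul, liftVal_smul, liftVal_smul]
    -- The only discrepancy is the product of the two `x` terms, both of which lie in `J`.
    linear_combination -φ.liftVal_mul_liftVal hμ _ (x.app (μ' ⁻¹ᵁ V) (π.delta hμ' V r))
      (x.app (μ' ⁻¹ᵁ V) (π.delta hμ' V s))

lemma thickenApp_apply (V : Z'.Opens) (r : Γ(Z', V)) :
    φ.thickenApp hμ π hμ' x V r = φ.hom.app _ (μ'.app V r) +
    φ.liftVal hμ _ (x.app (μ' ⁻¹ᵁ V) (π.delta hμ' V r)) := rfl

lemma thickenApp_res {U V : Z'.Opens} (hUV : U ≤ V) (r : Γ(Z', V)) :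
    φ.thickenApp hμ π hμ' x U (fres hUV r) =
      fres (φ.hom.preimage_mono (μ'.preimage_mono hUV)) (φ.thickenApp hμ π hμ' x V r) := by
  rw [thickenApp_apply, thickenApp_apply, fres_app, fres_app, delta_res, app_res, liftVal_res,
    map_add]

lemma app_thickenApp (V : Z'.Opens) (r : Γ(Z', V)) :
    μ.app _ (φ.thickenApp hμ π hμ' x V r) =
      fres (φ.preimage_preimage (μ' ⁻¹ᵁ V)).le (μ'.app V r) := by
  rw [thickenApp_apply, map_add, app_app, app_liftVal, add_zero]

/-- The morphism of presheafed spaces underlying `thicken`. -/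
def thickenAux : Z.toPresheafedSpace ⟶ Z'.toPresheafedSpace where
  base := φ.hom.base ≫ μ'.base
  c :=
    { app := fun V ↦ CommRingCat.ofHom (φ.thickenApp hμ π hμ' x V.unop)
      naturality := fun U V i ↦ by
        ext r
        exact φ.thickenApp_res hμ π hμ' x (leOfHom i.unop) r }

lemma comp_thickenAux : (μ.toLRSHom.toHom : X.toPresheafedSpace ⟶ _) ≫
    φ.thickenAux hμ π hμ' x = μ'.toLRSHom.toHom := by
  have hb : μ.base ≫ φ.hom.base ≫ μ'.base = μ'.base := by
    rw [← Scheme.Hom.comp_base, ← Scheme.Hom.comp_base, ← Category.assoc, φ.fac,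
      Category.id_comp]
  refine PresheafedSpace.Hom.ext _ _ hb ?_
  refine NatTrans.ext (funext fun V ↦ ?_)
  ext r
  refine (congrArg _ (φ.app_thickenApp hμ π hμ' x V.unop r)).trans ?_
  exact (fres_fres _ _ _).trans (fres_self _ _)

/-- The morphism `Z ⟶ Z'` under `X` given by a morphism of conormal sheaves, where `X` is a retract
of its square zero thickenings `Z` and `Z'`. -/
def thicken : Z ⟶ Z' where
  base := (φ.thickenAux hμ π hμ' x).base
  c := (φ.thickenAux hμ π hμ' x).c
  prop z := by
    -- Every point of `Z` is some `μ p`. Followed by the stalk map of `μ`, the stalk map in question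
    -- becomes that of `μ'`, which is local; the factor applied first in a local composite is local.
    obtain ⟨p, rfl⟩ := hμ.surjective z
    have h1 := PresheafedSpace.stalkMap.comp (μ.toLRSHom.toHom : X.toPresheafedSpace ⟶ _)
      (φ.thickenAux hμ π hμ' x) p
    have h2 : IsLocalHom ((μ.toLRSHom.toHom ≫ φ.thickenAux hμ π hμ' x).stalkMap p).hom := by
      rw [comp_thickenAux]
      exact μ'.toLRSHom.prop p
    rw [h1] at h2
    exact @isLocalHom_of_comp _ _ _ _ _ _ _ _ h2

lemma thicken_app (V : Z'.Opens) (r : Γ(Z', V)) :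
    (φ.thicken hμ π hμ' x).app V r = φ.thickenApp hμ π hμ' x V r := rfl

lemma comp_thicken : μ ≫ φ.thicken hμ π hμ' x = μ' := by
  refine Scheme.Hom.ext' ?_
  refine LocallyRingedSpace.Hom.ext' ?_
  exact φ.comp_thickenAux hμ π hμ' x

/-- `δ` vanishes on `π^♯ s`, so only the term `φ^♯ s` remains. -/
lemma thicken_comp : φ.thicken hμ π hμ' x ≫ π.hom = φ.hom := by
  have hb : (φ.thicken hμ π hμ' x ≫ π.hom).base = φ.hom.base := by
    change (φ.hom.base ≫ μ'.base) ≫ π.hom.base = _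
    rw [← Scheme.Hom.comp_base, ← Scheme.Hom.comp_base, Category.assoc, π.fac, Category.comp_id]
  refine hom_ext_of_app hb fun U s ↦ ?_
  change (φ.thicken hμ π hμ' x).app _ (π.hom.app U s) = _
  rw [thicken_app, thickenApp_apply, app_app, delta_app, map_zero, map_zero, add_zero, fres_app]
  rfl

end

end Retraction

/-! ### Morphisms of conormal sheaves from morphisms of thickenings -/

section

variable {μ : X ⟶ Z} {μ' : X ⟶ Z'} (θ : Z ⟶ Z') (hθ : μ ≫ θ = μ')

/-- The pullback of a function vanishing on `X`. -/
def idealPull (V : Z'.Opens) (j : Γ(ideal μ', V)) : Γ(ideal μ, θ ⁻¹ᵁ V) :=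
  idealMk μ (θ ⁻¹ᵁ V) (θ.app V (idealVal μ' V j)) (by
    rw [app_app_of_comp_eq hθ, app_idealVal, map_zero])

lemma idealVal_idealPull (V : Z'.Opens) (j : Γ(ideal μ', V)) :
    idealVal μ _ (idealPull θ hθ V j) = θ.app V (idealVal μ' V j) :=
  idealVal_idealMk _ _ _ _

/-- The morphism from the ideal sheaf of `X` in `Z'` to that of `X` in `Z`. -/
def idealMap : ideal μ' ⟶ (Scheme.Modules.pushforward θ).obj (ideal μ) :=
  homMk (N := (Scheme.Modules.pushforward θ).obj (ideal μ)) (fun V ↦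
    { toFun := fun j ↦ idealPull θ hθ V j
      map_add' := fun j j' ↦ by
        apply idealVal_injective μ (θ ⁻¹ᵁ V)
        refine Eq.trans ?_ (idealVal_add _ _ _ _).symm
        rw [idealVal_idealPull, idealVal_idealPull, idealVal_idealPull, idealVal_add, map_add]
      map_smul' := fun r j ↦ by
        apply idealVal_injective μ (θ ⁻¹ᵁ V)
        refine Eq.trans ?_ (idealVal_smul _ _ (θ.app V r) _).symm
        rw [idealVal_idealPull, idealVal_idealPull, idealVal_smul, map_mul] })
    (fun U V hUV j ↦ by
      apply idealVal_injective μ (θ ⁻¹ᵁ U)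
      refine Eq.trans ?_ (idealVal_res _ (θ.preimage_mono hUV) _).symm
      change idealVal _ _ (idealPull _ hθ _ _) = fres _ (idealVal _ _ (idealPull _ hθ _ _))
      rw [idealVal_idealPull, idealVal_idealPull, idealVal_res, fres_app])

lemma idealVal_idealMap (V : Z'.Opens) (j : Γ(ideal μ', V)) :
    idealVal μ (θ ⁻¹ᵁ V) (appTo θ (idealMap θ hθ) V j) = θ.app V (idealVal μ' V j) :=
  idealVal_idealPull _ hθ _ _

/-- The morphism of conormal sheaves given by a morphism of thickenings. -/
def conormalMap : conormal μ' ⟶ conormal μ :=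
  conormalDesc μ' (homMk (N := (Scheme.Modules.pushforward μ').obj (conormal μ)) (fun V ↦
    { toFun := fun j ↦ (res (conormal μ) (by rw [← hθ]; rfl)
        (cls μ (θ ⁻¹ᵁ V) (appTo θ (idealMap θ hθ) V j)) : Γ(conormal μ, μ' ⁻¹ᵁ V))
      map_add' := fun j j' ↦ by rw [map_add, map_add, map_add]; rfl
      map_smul' := fun r j ↦ by
        rw [appTo_smul, cls_smul, res_smul, app_app_of_comp_eq hθ, fres_fres, fres_self]
        rfl })
    (fun U V hUV j ↦ by
      refine Eq.trans ?_ (res_res (conormal μ) (μ'.preimage_mono hUV) _ _).symm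
      change res _ _ (cls _ _ _) = res _ _ (cls _ _ _)
      rw [appTo_res, cls_res, res_res]))

lemma conormalMap_cls (V : Z'.Opens) (j : Γ(ideal μ', V)) :
    (conormalMap θ hθ).app _ (cls μ' V j) = res (conormal μ) (by rw [← hθ]; rfl)
      (cls μ (θ ⁻¹ᵁ V) (appTo θ (idealMap θ hθ) V j)) :=
  conormalDesc_cls _ _ _ _

/-- For `j` in the ideal of `X` in `Z'` one has `μ'^♯ j = 0` and `δ j = [j]`, so `thicken` pulls `j`
back to the function given by `x [j]`. -/
lemma Retraction.conormalMap_thicken {f : X ⟶ B} {h : Z ⟶ B} (φ : Retraction μ f h)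
    (hμ : IsSquareZero μ) {h' : Z' ⟶ B} (π : Retraction μ' f h') (hμ' : IsSquareZero μ')
    (x : conormal μ' ⟶ conormal μ) :
    conormalMap (φ.thicken hμ π hμ' x) (φ.comp_thicken hμ π hμ' x) = x := by
  refine conormal_hom_ext fun V j ↦ ?_
  rw [conormalMap_cls]
  have h2 : π.delta hμ' V (idealVal μ' V j) = cls μ' V j := by
    refine congrArg (cls μ' V) (idealVal_injective μ' V ?_)
    rw [idealVal_idealPart, app_idealVal, map_zero, map_zero, sub_zero]
  have h3 : φ.thickenApp hμ π hμ' x V (idealVal μ' V j) =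
      idealVal μ _ (appTo φ.hom (φ.lift hμ) _ (x.app _ (cls μ' V j))) := by
    rw [thickenApp_apply, app_idealVal, map_zero, zero_add, liftVal_apply, h2]
  have h1 : appTo (φ.thicken hμ π hμ' x)
      (idealMap (φ.thicken hμ π hμ' x) (φ.comp_thicken hμ π hμ' x)) V j =
      appTo φ.hom (φ.lift hμ) _ (x.app _ (cls μ' V j)) :=
    idealVal_injective μ _ ((idealVal_idealMap (φ.thicken hμ π hμ' x)
      (φ.comp_thicken hμ π hμ' x) V j).trans h3)
  refine (congrArg (fun j ↦ res (conormal μ) _ (cls μ _ j)) h1).trans ?_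
  refine (congrArg (res (conormal μ) _) (φ.cls_lift hμ (μ' ⁻¹ᵁ V) _)).trans ?_
  exact (res_res (conormal μ) _ _ _).trans (res_self (conormal μ) _ _)

end

end

section

variable {X S Z Z' B : Scheme.{u}}

lemma function_ext {U : X.Opens} {r s : Γ(X, U)}
    (h : ∀ x ∈ U, ∃ (V : X.Opens) (hV : V ≤ U), x ∈ V ∧ fres hV r = fres hV s) : r = s := by
  choose V hV hx e using h
  exact TopCat.Sheaf.eq_of_locally_eq' X.sheaf (fun x : U ↦ V x.1 x.2) U
    (fun x ↦ homOfLE (hV x.1 x.2)) (fun x hxU ↦ TopologicalSpace.Opens.mem_iSup.2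
      ⟨⟨x, hxU⟩, hx x hxU⟩) r s (fun x ↦ e x.1 x.2)

/-! ## First order neighbourhoods -/

lemma nbhdι_app_surjective (i : X ⟶ S) (W : S.affineOpens) :
    Function.Surjective ((nbhdι i).app W) :=
  (i.ker ^ 2).subschemeι_app_surjective W

lemma nbhdι_app_eq_zero (i : X ⟶ S) (W : S.affineOpens) (r : Γ(S, W))
    (hr : r ∈ (i.ker ^ 2).ideal W) : (nbhdι i).app W r = 0 := by
  rw [← Scheme.IdealSheafData.ker_subschemeι_app] at hr
  exact RingHom.mem_ker.1 hr

lemma ker_nbhdι (i : X ⟶ S) : (nbhdι i).ker = i.ker ^ 2 :=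
  Scheme.IdealSheafData.ker_subschemeι _

lemma range_nbhdι (i : X ⟶ S) [IsClosedImmersion i] : Set.range (nbhdι i) = Set.range i := by
  refine (Scheme.IdealSheafData.range_subschemeι _).trans ?_
  rw [Scheme.IdealSheafData.support_pow _ _ two_ne_zero, Scheme.Hom.support_ker,
    i.isClosedEmbedding.isClosed_range.closure_eq]

/-- `I` and `I²` have the same support, and the inclusion of the neighbourhood into `S` is
injective. -/
lemma toNbhd_surjective (i : X ⟶ S) [IsClosedImmersion i] : Function.Surjective (toNbhd i) := by
  intro z
  obtain ⟨p, hp⟩ : nbhdι i z ∈ Set.range i := by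
    rw [← range_nbhdι]
    exact ⟨z, rfl⟩
  refine ⟨p, (nbhdι i).isClosedEmbedding.injective ?_⟩
  rw [← hp, ← Scheme.Hom.comp_apply, toNbhd_nbhdι]

/-- The neighbourhood has the topology induced from `S`, so preimages of affine open sets of `S`
form a basis of it. -/
lemma exists_affineOpens_nbhdι (i : X ⟶ S) (V : (nbhd i).Opens) (z : nbhd i) (hz : z ∈ V) :
    ∃ W : S.affineOpens, z ∈ nbhdι i ⁻¹ᵁ W ∧ nbhdι i ⁻¹ᵁ W ≤ V := by
  obtain ⟨T, hT, hTV⟩ := (nbhdι i).isClosedEmbedding.isInducing.isOpen_iff.1 V.isOpen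
  obtain ⟨_, ⟨W, hW, rfl⟩, hzW, hWT⟩ := S.isBasis_affineOpens.exists_subset_of_mem_open
    (show nbhdι i z ∈ T by rw [← Set.mem_preimage, hTV]; exact hz) hT
  refine ⟨⟨W, hW⟩, hzW, fun y hy ↦ ?_⟩
  have : y ∈ (V : Set (nbhd i)) := hTV ▸ hWT hy
  exact this

lemma mem_ker_ideal (i : X ⟶ S) [IsClosedImmersion i] (W : S.affineOpens) (a : Γ(S, W))
    (ha : i.app W.1 a = 0) : a ∈ i.ker.ideal W := by
  rw [Scheme.Hom.ker_apply]
  exact ha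

lemma app_eq_zero_of_comp_eq {f : X ⟶ Z} {g : Z ⟶ S} {e : X ⟶ S} (h : f ≫ g = e) (V : S.Opens)
    (r : Γ(S, V)) (hr : f.app (g ⁻¹ᵁ V) (g.app V r) = 0) : e.app V r = 0 := by
  subst h
  exact hr

lemma exists_mem_ker_nbhdι_app_eq (i : X ⟶ S) [IsClosedImmersion i] (W : S.affineOpens)
    (a : Γ(nbhd i, nbhdι i ⁻¹ᵁ W)) (ha : (toNbhd i).app _ a = 0) :
    ∃ a' ∈ i.ker.ideal W, (nbhdι i).app W a' = a := by
  obtain ⟨a', rfl⟩ := nbhdι_app_surjective i W a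
  exact ⟨a', mem_ker_ideal i W a' (app_eq_zero_of_comp_eq (toNbhd_nbhdι i) W.1 a' ha), rfl⟩

/-- Over an affine open set of `S`, functions on the neighbourhood lift to `S`. Lifts of functions
vanishing on `X` lie in `I`, so a product of two of them lies in `I²` and restricts to zero. -/
theorem isSquareZero_toNbhd (i : X ⟶ S) [IsClosedImmersion i] : IsSquareZero (toNbhd i) where
  surjective := toNbhd_surjective i
  mul_eq_zero V a b ha hb := by
    refine function_ext fun z hz ↦ ?_
    obtain ⟨W, hzW, hWV⟩ := exists_affineOpens_nbhdι i V z hz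
    refine ⟨nbhdι i ⁻¹ᵁ W, hWV, hzW, ?_⟩
    obtain ⟨a', ha', ea⟩ := exists_mem_ker_nbhdι_app_eq i W (fres hWV a)
      (by rw [fres_app, ha, map_zero])
    obtain ⟨b', hb', eb⟩ := exists_mem_ker_nbhdι_app_eq i W (fres hWV b)
      (by rw [fres_app, hb, map_zero])
    rw [map_mul, map_zero, ← ea, ← eb, ← map_mul]
    apply nbhdι_app_eq_zero
    rw [Scheme.IdealSheafData.ideal_pow, Pi.pow_apply, sq]
    exact Ideal.mul_mem_mul ha' hb'

/-! ## The morphism to the first order neighbourhood of the diagonal -/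

namespace Retraction

variable {μ : X ⟶ Z} {f : X ⟶ B} {h : Z ⟶ B} (ψ φ : Retraction μ f h)

/-- The morphism `Z ⟶ X ×_B X` given by two retractions. -/
def toProd : Z ⟶ pullback f f :=
  pullback.lift ψ.hom φ.hom (ψ.hom_comp.trans φ.hom_comp.symm)

lemma comp_toProd : μ ≫ toProd ψ φ = pullback.diagonal f := by
  apply pullback.hom_ext
  · rw [Category.assoc, toProd, pullback.lift_fst, ψ.fac, pullback.diagonal_fst]
  · rw [Category.assoc, toProd, pullback.lift_snd, φ.fac, pullback.diagonal_snd]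

/-- `Z` has no points besides those of `X`, and these map to the diagonal. -/
lemma range_toProd (hμ : IsSquareZero μ) :
    Set.range (toProd ψ φ) ⊆ Set.range (pullback.diagonal f).coborderRange.ι := by
  rintro _ ⟨z, rfl⟩
  obtain ⟨p, rfl⟩ := hμ.surjective z
  refine ⟨(pullback.diagonal f).liftCoborder p, ?_⟩
  rw [← Scheme.Hom.comp_apply, ← Scheme.Hom.comp_apply, comp_toProd, Scheme.Hom.liftCoborder_ι]

/-- The morphism to the open neighbourhood of the diagonal given by two retractions. -/
def toCoborder (hμ : IsSquareZero μ) : Z ⟶ (pullback.diagonal f).coborderRange :=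
  IsOpenImmersion.lift (pullback.diagonal f).coborderRange.ι (toProd ψ φ) (range_toProd ψ φ hμ)

lemma toCoborder_ι (hμ : IsSquareZero μ) :
    toCoborder ψ φ hμ ≫ (pullback.diagonal f).coborderRange.ι = toProd ψ φ :=
  IsOpenImmersion.lift_fac _ _ _

lemma comp_toCoborder (hμ : IsSquareZero μ) : μ ≫ toCoborder ψ φ hμ = diag f := by
  rw [← cancel_mono (pullback.diagonal f).coborderRange.ι, Category.assoc, toCoborder_ι,
    comp_toProd, diag, Scheme.Hom.liftCoborder_ι]

instance : IsClosedImmersion (diag f) :=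
  inferInstanceAs (IsClosedImmersion (pullback.diagonal f).liftCoborder)

/-- The universal property of the first order neighbourhood: `g` pulls functions vanishing on `X`
back into `J`, and `J² = 0`. -/
lemma ker_le_ker_of_comp_eq (hμ : IsSquareZero μ) (i : X ⟶ S) (g : Z ⟶ S) (hg : μ ≫ g = i) :
    (nbhdι i).ker ≤ g.ker := by
  rw [ker_nbhdι]
  -- The kernel of `g` is the largest ideal sheaf inside the kernels on affine open sets, so the
  -- inclusion may be checked there.
  refine Scheme.IdealSheafData.le_ofIdeals_iff.2 fun W ↦ ?_
  rw [Scheme.IdealSheafData.ideal_pow, Pi.pow_apply, sq, Ideal.mul_le]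
  have key : ∀ a ∈ i.ker.ideal W, μ.app _ (g.app W a) = 0 := fun a ha ↦ by
    have := i.ideal_ker_le W ha
    rw [RingHom.mem_ker] at this
    rw [app_app_of_comp_eq hg]
    refine (congrArg _ this).trans (map_zero _)
  intro a ha b hb
  rw [RingHom.mem_ker, map_mul]
  exact hμ.mul_eq_zero _ _ _ (key a ha) (key b hb)

/-- The morphism to the first order neighbourhood of the diagonal given by two retractions. -/
def toDiag (hμ : IsSquareZero μ) : Z ⟶ nbhd (diag f) :=
  IsClosedImmersion.lift (nbhdι (diag f)) (toCoborder ψ φ hμ)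
    (ker_le_ker_of_comp_eq hμ _ _ (comp_toCoborder ψ φ hμ))

lemma toDiag_nbhdι (hμ : IsSquareZero μ) :
    toDiag ψ φ hμ ≫ nbhdι (diag f) = toCoborder ψ φ hμ :=
  IsClosedImmersion.lift_fac _ _ _

lemma comp_toDiag (hμ : IsSquareZero μ) : μ ≫ toDiag ψ φ hμ = toNbhd (diag f) := by
  rw [← cancel_mono (nbhdι (diag f)), Category.assoc, toDiag_nbhdι, comp_toCoborder, toNbhd_nbhdι]

lemma toDiag_diagFst (hμ : IsSquareZero μ) : toDiag ψ φ hμ ≫ (diagFst f).hom = ψ.hom := by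
  rw [diagFst, ← Category.assoc, toDiag_nbhdι, ← Category.assoc, toCoborder_ι, toProd,
    pullback.lift_fst]

lemma toDiag_diagSnd (hμ : IsSquareZero μ) : toDiag ψ φ hμ ≫ (diagSnd f).hom = φ.hom := by
  rw [diagSnd, ← Category.assoc, toDiag_nbhdι, ← Category.assoc, toCoborder_ι, toProd,
    pullback.lift_snd]

/-- The neighbourhood of the diagonal is a subobject of `X ×_B X`, so a morphism into it is
determined by its two projections. -/
lemma eq_toDiag (hμ : IsSquareZero μ) (θ : Z ⟶ nbhd (diag f)) (h₁ : θ ≫ (diagFst f).hom = ψ.hom)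
    (h₂ : θ ≫ (diagSnd f).hom = φ.hom) : θ = toDiag ψ φ hμ := by
  rw [← cancel_mono (nbhdι (diag f)), ← cancel_mono (pullback.diagonal f).coborderRange.ι]
  apply pullback.hom_ext
  · rw [← toDiag_diagFst ψ φ hμ] at h₁
    simpa only [diagFst, Category.assoc] using h₁
  · rw [← toDiag_diagSnd ψ φ hμ] at h₂
    simpa only [diagSnd, Category.assoc] using h₂

/-! ### Translation -/

/-- `diff` is defined by a choice over `common ψ φ U`. Since `idealVal` is injective, it can be
computed from any section representing the difference, over any suitable `V`. -/
lemma diff_eq (V : Z.Opens) (U : X.Opens) (s : Γ(X, U)) (h₁ : V ≤ ψ.hom ⁻¹ᵁ U)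
    (h₂ : V ≤ φ.hom ⁻¹ᵁ U) (hU : U ≤ μ ⁻¹ᵁ V) (j : Γ(ideal μ, V))
    (hj : idealVal μ V j = fres h₁ (ψ.hom.app U s) - fres h₂ (φ.hom.app U s)) :
    diff ψ φ U s = res (conormal μ) hU (cls μ V j) := by
  obtain ⟨j₀, hj₀⟩ : ∃ j₀ : Γ(ideal μ, common ψ φ U),
      idealVal μ _ j₀ = diffFun ψ φ U s ∧
      diff ψ φ U s = res (conormal μ) (preimage_common ψ φ U).ge (cls μ _ j₀) :=
    ⟨_, (exists_idealVal_eq μ _ _ (app_diffFun ψ φ U s)).choose_spec, rfl⟩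
  have h3 : V ≤ common ψ φ U := le_inf h₁ h₂
  have : j = res _ h3 j₀ := by
    apply idealVal_injective
    rw [hj, idealVal_res, hj₀.1]
    refine Eq.trans ?_ (map_sub (fres h3) _ _).symm
    exact congr($((fres_fres h3 inf_le_left _).symm) - $((fres_fres h3 inf_le_right _).symm))
  rw [hj₀.2, this, cls_res, res_res]

lemma preimage_eq (hμ : IsSquareZero μ) (U : X.Opens) : ψ.hom ⁻¹ᵁ U = φ.hom ⁻¹ᵁ U := by
  have := ψ.preimage_preimage' hμ (φ.hom ⁻¹ᵁ U)
  rwa [φ.preimage_preimage] at this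

variable {ψ φ} in
-- On points every retraction is the inverse of the bijection `μ`. On functions, `cls_injective`
-- recovers `ψ^♯ s - φ^♯ s` from its class.
lemma ext_of_diff_eq (hμ : IsSquareZero μ) {ψ' : Retraction μ f h}
    (e : ∀ U s, diff ψ φ U s = diff ψ' φ U s) : ψ = ψ' := by
  have hb : ψ.hom.base = ψ'.hom.base := by
    ext z
    obtain ⟨p, rfl⟩ := hμ.surjective z
    rw [← Scheme.Hom.comp_apply, ← Scheme.Hom.comp_apply, ψ.fac, ψ'.fac]
  refine Retraction.ext (hom_ext_of_app hb fun U s ↦ ?_)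
  have key : ∀ ψ : Retraction μ f h, ∃ j : Γ(ideal μ, φ.hom ⁻¹ᵁ U), idealVal μ _ j =
      fres (preimage_eq ψ φ hμ U).ge (ψ.hom.app U s) - φ.hom.app U s := fun ψ ↦ by
    refine ⟨idealMk μ _ _ ?_, idealVal_idealMk _ _ _ _⟩
    rw [map_sub, app_app, fres_app, app_app, fres_fres, sub_self]
  obtain ⟨j, hj⟩ := key ψ
  obtain ⟨j', hj'⟩ := key ψ'
  have h1 := diff_eq ψ φ (φ.hom ⁻¹ᵁ U) U s (preimage_eq ψ φ hμ U).ge le_rfl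
    (φ.preimage_preimage U).ge j (by rw [hj, fres_self])
  have h2 := diff_eq ψ' φ (φ.hom ⁻¹ᵁ U) U s (preimage_eq ψ' φ hμ U).ge le_rfl
    (φ.preimage_preimage U).ge j' (by rw [hj', fres_self])
  rw [e, h2] at h1
  have h3 := φ.cls_injective hμ _ (res_injective _ _ (φ.preimage_preimage U).le h1)
  rw [h3, hj, sub_left_inj] at hj'
  have h4 := congr(fres (preimage_eq ψ φ hμ U).le $hj')
  rwa [fres_fres, fres_fres, fres_self] at h4

/-- `θ^♯` sends `π₁^♯ s - π₂^♯ s` to `ψ^♯ s - φ^♯ s`. For the diagonal this says that `conormalMap θ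
hθ` takes `d s` to the difference of the two splittings. -/
lemma conormalMap_diff {μ' : X ⟶ Z'} {h' : Z' ⟶ B} (π₁ π₂ : Retraction μ' f h')
    (hμ' : IsSquareZero μ') (θ : Z ⟶ Z') (hθ : μ ≫ θ = μ') (h₁ : θ ≫ π₁.hom = ψ.hom)
    (h₂ : θ ≫ π₂.hom = φ.hom) (U : X.Opens) (s : Γ(X, U)) :
    (conormalMap θ hθ).app U (diff π₁ π₂ U s) = diff ψ φ U s := by
  obtain ⟨j, hj⟩ : ∃ j : Γ(ideal μ', π₂.hom ⁻¹ᵁ U), idealVal μ' _ j =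
      fres (preimage_eq π₁ π₂ hμ' U).ge (π₁.hom.app U s) - π₂.hom.app U s := by
    refine ⟨idealMk μ' _ _ ?_, idealVal_idealMk _ _ _ _⟩
    rw [map_sub, app_app, fres_app, app_app, fres_fres, sub_self]
  rw [diff_eq π₁ π₂ (π₂.hom ⁻¹ᵁ U) U s (preimage_eq π₁ π₂ hμ' U).ge le_rfl
    (π₂.preimage_preimage U).ge j (by rw [hj, fres_self]), app_res, conormalMap_cls, res_res]
  have e₁ : θ ⁻¹ᵁ π₁.hom ⁻¹ᵁ U = ψ.hom ⁻¹ᵁ U := by rw [← h₁]; rfl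
  have e₂ : θ ⁻¹ᵁ π₂.hom ⁻¹ᵁ U = φ.hom ⁻¹ᵁ U := by rw [← h₂]; rfl
  have e₃ : θ ⁻¹ᵁ π₂.hom ⁻¹ᵁ U ≤ ψ.hom ⁻¹ᵁ U := by
    rw [← e₁, preimage_eq π₁ π₂ hμ' U]
  refine (diff_eq ψ φ _ U s e₃ e₂.le _ _ ?_).symm
  rw [idealVal_idealMap, hj, map_sub, fres_app, app_app_of_comp_eq h₁, app_app_of_comp_eq h₂,
    fres_fres]

end Retraction

end

/-! ### Functoriality of the extension in the thickening -/

section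

variable {X Y Z Z' B : Scheme.{u}}

lemma preimage_le_of_comp_eq {f : X ⟶ Y} {g : Y ⟶ Z} {e : X ⟶ Z} (h : f ≫ g = e) (U : Z.Opens) :
    e ⁻¹ᵁ U ≤ f ⁻¹ᵁ g ⁻¹ᵁ U := by
  subst h
  exact le_rfl

lemma le_preimage_of_comp_eq {f : X ⟶ Y} {g : Y ⟶ Z} {e : X ⟶ Z} (h : f ≫ g = e) (U : Z.Opens) :
    f ⁻¹ᵁ g ⁻¹ᵁ U ≤ e ⁻¹ᵁ U := by
  subst h
  exact le_rfl

/-- The canonical isomorphism `g_* f_* M = e_* M`, where `e = f ≫ g`, as a morphism. -/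
def pushComp {f : X ⟶ Y} {g : Y ⟶ Z} {e : X ⟶ Z} (h : f ≫ g = e) (M : X.Modules) :
    (Scheme.Modules.pushforward g).obj ((Scheme.Modules.pushforward f).obj M) ⟶
      (Scheme.Modules.pushforward e).obj M :=
  (Scheme.Modules.pushforwardComp f g ≪≫ Scheme.Modules.pushforwardCongr h).hom.app M

lemma pushComp_app {f : X ⟶ Y} {g : Y ⟶ Z} {e : X ⟶ Z} (h : f ≫ g = e) (M : X.Modules)
    (U : Z.Opens) (m : Γ(M, f ⁻¹ᵁ g ⁻¹ᵁ U)) :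
    (pushComp h M).app U m = res M (preimage_le_of_comp_eq h U) m := by
  subst h
  rfl

namespace Retraction

variable {μ : X ⟶ Z} {f : X ⟶ B} {h : Z ⟶ B} (ψ φ : Retraction μ f h)
  {μ' : X ⟶ Z'} {f' : X ⟶ B} {h' : Z' ⟶ B} (π₁ π₂ : Retraction μ' f' h')
  {θ : Z ⟶ Z'} (hθ : μ ≫ θ = μ') (h₁ : θ ≫ π₁.hom = ψ.hom) (h₂ : θ ≫ π₂.hom = φ.hom)
  (E : X.Modules)

/-- The canonical morphism `π₁^* E ⟶ θ_* ψ^* E`, where `ψ = π₁ θ`. -/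
def pullMap : (Scheme.Modules.pullback π₁.hom).obj E ⟶
    (Scheme.Modules.pushforward θ).obj ((Scheme.Modules.pullback ψ.hom).obj E) :=
  pullDesc π₁.hom (homMk (N := (Scheme.Modules.pushforward π₁.hom).obj
      ((Scheme.Modules.pushforward θ).obj ((Scheme.Modules.pullback ψ.hom).obj E)))
    (fun U ↦
      { toFun := fun e ↦ (res _ (le_preimage_of_comp_eq h₁ U)
          (pull ψ.hom E U e) : Γ((Scheme.Modules.pullback ψ.hom).obj E, θ ⁻¹ᵁ π₁.hom ⁻¹ᵁ U))
        map_add' := fun e e' ↦ by rw [map_add, map_add]; rfl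
        map_smul' := fun r e ↦ by
          rw [pull_smul, res_smul, ← app_app_of_comp_eq h₁]
          rfl })
    (fun U V hUV e ↦ by
      refine Eq.trans ?_ (res_res _ (θ.preimage_mono (π₁.hom.preimage_mono hUV)) _ _).symm
      change res _ _ (pull ψ.hom E U (res _ _ e)) = _
      rw [pull_res, res_res]))

lemma pullMap_pull (U : X.Opens) (e : Γ(E, U)) :
    appTo θ (pullMap ψ π₁ h₁ E) (π₁.hom ⁻¹ᵁ U) (pull π₁.hom E U e) =
      res _ (le_preimage_of_comp_eq h₁ U) (pull ψ.hom E U e) :=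
  pullDesc_pull π₁.hom _ U e

lemma quo_pullMap (V : Z'.Opens) (m : Γ((Scheme.Modules.pullback π₁.hom).obj E, V)) :
    appTo μ (ψ.quo E) (θ ⁻¹ᵁ V) (appTo θ (pullMap ψ π₁ h₁ E) V m) =
      res E (le_preimage_of_comp_eq hθ V) (appTo μ' (π₁.quo E) V m) := by
  -- Restricting to `X` directly or through `Z` gives the same morphism, because both send `π₁^* e`
  -- to `e`.
  have key : pullMap ψ π₁ h₁ E ≫ (Scheme.Modules.pushforward θ).map (ψ.quo E) ≫
      pushComp hθ E = π₁.quo E := by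
    refine pullback_hom_ext fun U e ↦ ?_
    refine Eq.trans ?_ (π₁.quo_pull E U e).symm
    have h3 : appTo μ (ψ.quo E) (θ ⁻¹ᵁ π₁.hom ⁻¹ᵁ U)
        (appTo θ (pullMap ψ π₁ h₁ E) (π₁.hom ⁻¹ᵁ U) (pull π₁.hom E U e)) =
        res E (show μ ⁻¹ᵁ θ ⁻¹ᵁ π₁.hom ⁻¹ᵁ U ≤ U by
          rw [← Scheme.Hom.comp_preimage, ← Scheme.Hom.comp_preimage, Category.assoc, h₁, ψ.fac]
          rfl) e := by
      rw [pullMap_pull, appTo_res, quo_pull, res_res]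
    refine (pushComp_app hθ E (π₁.hom ⁻¹ᵁ U) _).trans ?_
    refine (congrArg (res E _) h3).trans ?_
    exact res_res E _ _ _
  have h4 := congr($(key).app V m)
  have h5 := (pushComp_app hθ E V (appTo μ (ψ.quo E) (θ ⁻¹ᵁ V)
    (appTo θ (pullMap ψ π₁ h₁ E) V m))).symm.trans h4
  refine Eq.trans ?_ (congrArg (res E _) h5)
  exact ((res_res E _ _ _).trans (res_self E _ _)).symm

/-- The canonical morphism `π₁^* E ⊗ J' ⟶ θ_* (ψ^* E ⊗ J)`. -/
def tensorPullMap : tensor ((Scheme.Modules.pullback π₁.hom).obj E) (ideal μ') ⟶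
    (Scheme.Modules.pushforward θ).obj
      (tensor ((Scheme.Modules.pullback ψ.hom).obj E) (ideal μ)) :=
  tensorMap (pullMap ψ π₁ h₁ E) (idealMap θ hθ) ≫ pushforwardTensor θ _ _

lemma tensorPullMap_tmul (V : Z'.Opens) (m : Γ((Scheme.Modules.pullback π₁.hom).obj E, V))
    (j : Γ(ideal μ', V)) :
    appTo θ (tensorPullMap ψ π₁ hθ h₁ E) V (tmul _ _ V m j) =
      tmul _ _ (θ ⁻¹ᵁ V) (appTo θ (pullMap ψ π₁ h₁ E) V m) (appTo θ (idealMap θ hθ) V j) := by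
  have h1 := tensorMap_tmul (pullMap ψ π₁ h₁ E) (idealMap θ hθ) V m j
  have h2 := pushforwardTensor_tmul θ ((Scheme.Modules.pullback ψ.hom).obj E) (ideal μ) V
    (appTo θ (pullMap ψ π₁ h₁ E) V m) (appTo θ (idealMap θ hθ) V j)
  exact (congrArg _ h1).trans h2

lemma tensorPullMap_idealAction :
    tensorPullMap ψ π₁ hθ h₁ E ≫ (Scheme.Modules.pushforward θ).map (idealAction μ _) =
      idealAction μ' _ ≫ pullMap ψ π₁ h₁ E := by
  refine tensor_hom_ext fun V m j ↦ ?_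
  have e1 := tensorPullMap_tmul ψ π₁ hθ h₁ E V m j
  have e2 := idealAction_tmul μ ((Scheme.Modules.pullback ψ.hom).obj E) (θ ⁻¹ᵁ V)
    (appTo θ (pullMap ψ π₁ h₁ E) V m) (appTo θ (idealMap θ hθ) V j)
  have e3 := idealAction_tmul μ' ((Scheme.Modules.pullback π₁.hom).obj E) V m j
  refine ((congrArg ((idealAction μ _).app (θ ⁻¹ᵁ V)) e1).trans e2).trans ?_
  refine Eq.trans ?_ (congrArg (appTo θ (pullMap ψ π₁ h₁ E) V) e3).symm
  rw [appTo_smul, idealVal_idealMap]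

lemma proj_tensorPullMap (V : Z'.Opens)
    (t : Γ(tensor ((Scheme.Modules.pullback π₁.hom).obj E) (ideal μ'), V)) :
    appTo μ (ψ.proj E) (θ ⁻¹ᵁ V) (appTo θ (tensorPullMap ψ π₁ hθ h₁ E) V t) =
      res (tensor E (conormal μ)) (le_preimage_of_comp_eq hθ V)
        ((tensorMap (𝟙 E) (conormalMap θ hθ)).app _ (appTo μ' (π₁.proj E) V t)) := by
  have key : tensorPullMap ψ π₁ hθ h₁ E ≫ (Scheme.Modules.pushforward θ).map (ψ.proj E) ≫
      pushComp hθ _ = π₁.proj E ≫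
        (Scheme.Modules.pushforward μ').map (tensorMap (𝟙 E) (conormalMap θ hθ)) := by
    refine tensor_hom_ext fun V m j ↦ ?_
    have e1 : appTo μ (ψ.proj E) (θ ⁻¹ᵁ V) (appTo θ (tensorPullMap ψ π₁ hθ h₁ E) V
        (tmul _ _ V m j)) = tmul E (conormal μ) _
          (res E (le_preimage_of_comp_eq hθ V) (appTo μ' (π₁.quo E) V m))
          (cls μ _ (appTo θ (idealMap θ hθ) V j)) := by
      rw [tensorPullMap_tmul, proj_tmul, quo_pullMap ψ π₁ hθ]
    have e2 : (tensorMap (𝟙 E) (conormalMap θ hθ)).app _ (appTo μ' (π₁.proj E) V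
        (tmul _ _ V m j)) = tmul E (conormal μ) _ (appTo μ' (π₁.quo E) V m)
          (res (conormal μ) (preimage_le_of_comp_eq hθ V) (cls μ _ (appTo θ (idealMap θ hθ) V j))) := by
      rw [proj_tmul, tensorMap_tmul, conormalMap_cls]
      rfl
    refine Eq.trans ?_ e2.symm
    refine (pushComp_app hθ (tensor E (conormal μ)) V (appTo μ (ψ.proj E) (θ ⁻¹ᵁ V)
      (appTo θ (tensorPullMap ψ π₁ hθ h₁ E) V (tmul _ _ V m j)))).trans ?_
    rw [e1, res_tmul, res_res, res_self]
  have h4 := congr($(key).app V t)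
  have h5 := (pushComp_app hθ _ V (appTo μ (ψ.proj E) (θ ⁻¹ᵁ V)
    (appTo θ (tensorPullMap ψ π₁ hθ h₁ E) V t))).symm.trans h4
  refine Eq.trans ?_ (congrArg (res (tensor E (conormal μ)) _) h5)
  exact ((res_res (tensor E (conormal μ)) _ _ _).trans
    (res_self (tensor E (conormal μ)) _ _)).symm

/-- The functoriality of `extension`. -/
def extensionMap : extension π₁ π₂ E ⟶ extension ψ φ E where
  τ₁ := (Scheme.Modules.pushforward π₂.hom).map (tensorPullMap ψ π₁ hθ h₁ E) ≫ pushComp h₂ _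
  τ₂ := (Scheme.Modules.pushforward π₂.hom).map (pullMap ψ π₁ h₁ E) ≫ pushComp h₂ _
  τ₃ := 𝟙 E
  comm₁₂ := by
    have e : pushComp h₂ _ ≫ (Scheme.Modules.pushforward φ.hom).map
        (idealAction μ ((Scheme.Modules.pullback ψ.hom).obj E)) =
        (Scheme.Modules.pushforward π₂.hom).map ((Scheme.Modules.pushforward θ).map
          (idealAction μ _)) ≫ pushComp h₂ _ :=
      ((Scheme.Modules.pushforwardComp θ π₂.hom ≪≫
        Scheme.Modules.pushforwardCongr h₂).hom.naturality _).symm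
    have e2 := congr((Scheme.Modules.pushforward π₂.hom).map
      $(tensorPullMap_idealAction ψ π₁ hθ h₁ E))
    rw [Functor.map_comp, Functor.map_comp] at e2
    refine (Category.assoc _ _ _).trans ((congrArg _ e).trans ?_)
    refine (Category.assoc _ _ _).symm.trans ((congrArg (· ≫ pushComp h₂ _) e2).trans ?_)
    exact Category.assoc _ _ _
  comm₂₃ := by
    refine modules_hom_ext fun U (m : Γ((Scheme.Modules.pullback π₁.hom).obj E, π₂.hom ⁻¹ᵁ U)) ↦ ?_
    have e1 := quotientMap_app ψ φ E U (res _ (preimage_le_of_comp_eq h₂ U)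
      (appTo θ (pullMap ψ π₁ h₁ E) (π₂.hom ⁻¹ᵁ U) m))
    have e2 := quotientMap_app π₁ π₂ E U m
    refine (congrArg ((quotientMap ψ φ E).app U) (pushComp_app h₂ _ U
      (appTo θ (pullMap ψ π₁ h₁ E) (π₂.hom ⁻¹ᵁ U) m))).trans (e1.trans ?_)
    refine Eq.trans ?_ e2.symm
    rw [appTo_res, quo_pullMap ψ π₁ hθ, res_res, res_res]

/-- After the projection formula, the map of extensions is `id ⊗ conormalMap` on the kernels: pure
tensors `m ⊗ j` go to `m|_X ⊗ [θ^♯ j]` either way. -/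
lemma extensionMap_projectionFormula :
    (extensionMap ψ φ π₁ π₂ hθ h₁ h₂ E).τ₁ ≫ projectionFormula ψ φ E =
      projectionFormula π₁ π₂ E ≫ tensorMap (𝟙 E) (conormalMap θ hθ) := by
  refine modules_hom_ext fun U (t : Γ(tensor
    ((Scheme.Modules.pullback π₁.hom).obj E) (ideal μ'), π₂.hom ⁻¹ᵁ U)) ↦ ?_
  have e1 := projectionFormula_app ψ φ E U (res _ (preimage_le_of_comp_eq h₂ U)
    (appTo θ (tensorPullMap ψ π₁ hθ h₁ E) (π₂.hom ⁻¹ᵁ U) t))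
  have e2 := projectionFormula_app π₁ π₂ E U t
  refine (congrArg ((projectionFormula ψ φ E).app U) (pushComp_app h₂ _ U
      (appTo θ (tensorPullMap ψ π₁ hθ h₁ E) (π₂.hom ⁻¹ᵁ U) t))).trans (e1.trans ?_)
  refine Eq.trans ?_ (congrArg ((tensorMap (𝟙 E) (conormalMap θ hθ)).app U) e2).symm
  rw [appTo_res, proj_tensorPullMap, app_res]
  exact (congrArg (res (tensor E (conormal μ)) _) (res_res (tensor E (conormal μ)) _ _ _)).trans
    (res_res (tensor E (conormal μ)) _ _ _)

lemma atiyahClass_eq [HasExt.{w} X.Modules] (h₁ : θ ≫ π₁.hom = ψ.hom)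
    (h₂ : θ ≫ π₂.hom = φ.hom) (hE : (extension ψ φ E).ShortExact)
    (hE' : (extension π₁ π₂ E).ShortExact) :
    atiyahClass ψ φ E hE = (atiyahClass π₁ π₂ E hE').comp
      (Abelian.Ext.mk₀ (tensorMap (𝟙 E) (conormalMap θ hθ))) (add_zero 1) := by
  have e := ShortComplex.ShortExact.extClass_naturality hE' hE
    (extensionMap ψ φ π₁ π₂ hθ h₁ h₂ E)
  -- The map of extensions is the identity on the quotient `E`, so naturality says that one class is
  -- the pushforward of the other.
  have e' : hE'.extClass.comp (Abelian.Ext.mk₀ (extensionMap ψ φ π₁ π₂ hθ h₁ h₂ E).τ₁)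
      (add_zero 1) = hE.extClass := e.trans (Abelian.Ext.mk₀_id_comp _)
  refine (congrArg (fun a ↦ a.comp (Abelian.Ext.mk₀ (projectionFormula ψ φ E)) (add_zero 1))
    e'.symm).trans ?_
  refine (Abelian.Ext.comp_assoc_of_third_deg_zero _ _ _ _).trans ?_
  refine Eq.trans ?_ (Abelian.Ext.comp_assoc_of_third_deg_zero _ _ _ _).symm
  rw [Abelian.Ext.mk₀_comp_mk₀, Abelian.Ext.mk₀_comp_mk₀, extensionMap_projectionFormula]

end Retraction

end

section

variable {X S B : Scheme.{u}}

/-! ## Linearity of the tensor product -/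

lemma tensorMap_add_right {M N N' : X.Modules} (a b : N ⟶ N') :
    tensorMap (𝟙 M) (a + b) = tensorMap (𝟙 M) a + tensorMap (𝟙 M) b := by
  refine tensor_hom_ext fun U m n ↦ ?_
  rw [tensorMap_tmul]
  refine Eq.trans ?_ (congr_arg₂ (· + ·) (tensorMap_tmul (𝟙 M) a U m n)
    (tensorMap_tmul (𝟙 M) b U m n)).symm
  exact map_add (tmul M N' U m) (a.app U n) (b.app U n)

lemma tensorMap_smul_right {k : Type u} [CommRing k] (f : X ⟶ Spec (.of k))
    {M N N' : X.Modules} (c : k) (a : N ⟶ N') :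
    letI := linearOver f
    tensorMap (𝟙 M) (c • a) = c • tensorMap (𝟙 M) a := by
  refine tensor_hom_ext fun U m n ↦ ?_
  rw [tensorMap_tmul]
  refine Eq.trans ?_ (congrArg (globalScalar f U c • ·) (tensorMap_tmul (𝟙 M) a U m n)).symm
  exact map_smul (tmul M N' U m) (globalScalar f U c) (a.app U n)

/-! ## Translation of first order splittings -/

section Translate

variable {f : X ⟶ B} {g : S ⟶ B} {i : X ⟶ S} [IsClosedImmersion i] (φ : Splitting i f g)

/-- The morphism from the first order neighbourhood of `X` in `S` to that of the diagonal given by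
`φ` and `x : Ω_X ⟶ I / I²`. -/
def translateAux (x : cotangent f ⟶ conormalBundle i) : nbhd i ⟶ nbhd (diag f) :=
  φ.thicken (isSquareZero_toNbhd i) (diagSnd f) (isSquareZero_toNbhd (diag f)) x

lemma comp_translateAux (x : cotangent f ⟶ conormalBundle i) :
    toNbhd i ≫ translateAux φ x = toNbhd (diag f) :=
  φ.comp_thicken _ _ _ _

lemma translateAux_diagSnd (x : cotangent f ⟶ conormalBundle i) :
    translateAux φ x ≫ (diagSnd f).hom = φ.hom :=
  φ.thicken_comp _ _ _ _

lemma conormalMap_translateAux (x : cotangent f ⟶ conormalBundle i) :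
    conormalMap (translateAux φ x) (comp_translateAux φ x) = x :=
  φ.conormalMap_thicken _ _ _ _

/-- The splitting `φ + x`. -/
def translate (x : cotangent f ⟶ conormalBundle i) : Splitting i f g where
  hom := translateAux φ x ≫ (diagFst f).hom
  fac := by rw [← Category.assoc, comp_translateAux, (diagFst f).fac]
  hom_comp := by
    rw [Category.assoc, (diagFst f).hom_comp, ← (diagSnd f).hom_comp, ← Category.assoc,
      translateAux_diagSnd, φ.hom_comp]

lemma isTranslate_translate (x : cotangent f ⟶ conormalBundle i) :
    IsTranslate φ x (translate φ x) := fun U s ↦ by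
  rw [← Retraction.conormalMap_diff (translate φ x) φ (diagFst f) (diagSnd f)
    (isSquareZero_toNbhd (diag f)) (translateAux φ x) (comp_translateAux φ x) rfl
    (translateAux_diagSnd φ x), conormalMap_translateAux]
  rfl

lemma IsTranslate.eq_translate {x : cotangent f ⟶ conormalBundle i} {ψ : Splitting i f g}
    (h : IsTranslate φ x ψ) : translate φ x = ψ :=
  Retraction.ext_of_diff_eq (isSquareZero_toNbhd i) fun U s ↦
    (isTranslate_translate φ x U s).trans (h U s).symm

/-- `φ + x` and `φ` are the two projections of `translateAux φ x`, hence determine it, and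
`conormalMap` recovers `x` from it. -/
lemma translate_injective : Function.Injective (translate φ) := fun x y e ↦ by
  have hx := Retraction.eq_toDiag (translate φ x) φ (isSquareZero_toNbhd i) (translateAux φ x) rfl
    (translateAux_diagSnd φ x)
  have hy := Retraction.eq_toDiag (translate φ y) φ (isSquareZero_toNbhd i) (translateAux φ y) rfl
    (translateAux_diagSnd φ y)
  have h : translateAux φ x = translateAux φ y := by rw [hx, hy, e]
  rw [← conormalMap_translateAux φ x, ← conormalMap_translateAux φ y]
  congr 1

/-- Given `ψ`, take for `x` the conormal map of the morphism `(ψ, φ)` to the neighbourhood of the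
diagonal. -/
lemma translate_surjective : Function.Surjective (translate φ) := fun ψ ↦ by
  refine ⟨conormalMap (Retraction.toDiag ψ φ (isSquareZero_toNbhd i))
    (Retraction.comp_toDiag ψ φ _), IsTranslate.eq_translate φ fun U s ↦ ?_⟩
  exact (Retraction.conormalMap_diff ψ φ (diagFst f) (diagSnd f) (isSquareZero_toNbhd (diag f)) _
    _ (Retraction.toDiag_diagFst ψ φ _) (Retraction.toDiag_diagSnd ψ φ _) U s).symm

/-- The bijection `x ↦ φ + x`. -/
def translateEquiv : (cotangent f ⟶ conormalBundle i) ≃ Splitting i f g :=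
  Equiv.ofBijective (translate φ) ⟨translate_injective φ, translate_surjective φ⟩

lemma atiyahClass_translate [HasExt.{w} X.Modules] (x : cotangent f ⟶ conormalBundle i)
    (E : X.Modules) (hE : ((translate φ x).extension φ E).ShortExact)
    (hat : ((diagFst f).extension (diagSnd f) E).ShortExact) :
    (translate φ x).atiyahClass φ E hE = ((diagFst f).atiyahClass (diagSnd f) E hat).comp
      (Abelian.Ext.mk₀ (tensorMap (𝟙 E) x)) (add_zero 1) := by
  rw [Retraction.atiyahClass_eq (translate φ x) φ (diagFst f) (diagSnd f)
    (comp_translateAux φ x) E rfl (translateAux_diagSnd φ x) hE hat, conormalMap_translateAux]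

end Translate

end

end

end FirstOrder

theorem mainTheorem9 {k : Type u} [Field k] [CharZero k] {X S : Scheme.{u}}
    (f : X ⟶ Spec (.of k)) (g : S ⟶ Spec (.of k)) [Smooth f] [Smooth g]
    (i : X ⟶ S) [IsClosedImmersion i] (hi : i ≫ g = f) [HasExt.{w} X.Modules] :
    letI : Linear k X.Modules := FirstOrder.linearOver f
    ∃ translate : FirstOrder.Splitting i f g →
        ((FirstOrder.cotangent f ⟶ FirstOrder.conormalBundle i) ≃ FirstOrder.Splitting i f g),
      (∀ φ x ψ, translate φ x = ψ ↔ FirstOrder.IsTranslate φ x ψ) ∧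
      ∀ E : X.Modules, FirstOrder.IsVectorBundle E →
        ∃ (hα : ∀ φ₁ φ₂ : FirstOrder.Splitting i f g, (φ₁.extension φ₂ E).ShortExact)
          (hat : ((FirstOrder.diagFst f).extension (FirstOrder.diagSnd f) E).ShortExact),
          (∀ φ₁ φ₂ : FirstOrder.Splitting i f g, IsIso (φ₁.projectionFormula φ₂ E)) ∧
          IsIso ((FirstOrder.diagFst f).projectionFormula (FirstOrder.diagSnd f) E) ∧
          (∀ φ, IsLinearMap k fun x : FirstOrder.cotangent f ⟶ FirstOrder.conormalBundle i ↦
            (translate φ x).atiyahClass φ E (hα (translate φ x) φ)) ∧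
          (∀ φ x, (translate φ x).atiyahClass φ E (hα (translate φ x) φ) =
            ((FirstOrder.diagFst f).atiyahClass (FirstOrder.diagSnd f) E hat).comp
              (Abelian.Ext.mk₀ (FirstOrder.tensorMap (𝟙 E) x)) (add_zero 1)) ∧
          ∀ φ φ' x, (translate φ x).atiyahClass φ E (hα (translate φ x) φ) =
            (translate φ' x).atiyahClass φ' E (hα (translate φ' x) φ') := by
  let : Linear k X.Modules := FirstOrder.linearOver f
  have hS := FirstOrder.isSquareZero_toNbhd i
  have hD := FirstOrder.isSquareZero_toNbhd (FirstOrder.diag f)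
  refine ⟨FirstOrder.translateEquiv, fun φ x ψ ↦ ⟨?_, fun h ↦ h.eq_translate⟩, fun E _ ↦ ?_⟩
  · rintro rfl
    exact FirstOrder.isTranslate_translate φ x
  have hα (φ₁ φ₂ : FirstOrder.Splitting i f g) : (φ₁.extension φ₂ E).ShortExact :=
    FirstOrder.Retraction.extension_shortExact hS φ₁ φ₂ E
  have hat : ((FirstOrder.diagFst f).extension (FirstOrder.diagSnd f) E).ShortExact :=
    FirstOrder.Retraction.extension_shortExact hD _ _ E
  -- The right-hand side does not involve `φ` and is linear in `x`; the remaining claims about `Θ_φ`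
  -- follow from that.
  have key (φ : FirstOrder.Splitting i f g) x :
      (FirstOrder.translateEquiv φ x).atiyahClass φ E (hα _ φ) =
        ((FirstOrder.diagFst f).atiyahClass (FirstOrder.diagSnd f) E hat).comp
          (Abelian.Ext.mk₀ (FirstOrder.tensorMap (𝟙 E) x)) (add_zero 1) :=
    FirstOrder.atiyahClass_translate φ x E _ hat
  refine ⟨hα, hat, fun φ₁ φ₂ ↦ FirstOrder.Retraction.isIso_projectionFormula hS φ₁ φ₂ E,
    FirstOrder.Retraction.isIso_projectionFormula hD _ _ E, fun φ ↦ ⟨fun x y ↦ ?_, fun c x ↦ ?_⟩,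
    key, fun φ φ' x ↦ (key φ x).trans (key φ' x).symm⟩
  · rw [key, key, key, FirstOrder.tensorMap_add_right, Abelian.Ext.mk₀_add, Abelian.Ext.comp_add]
  · rw [key, key, FirstOrder.tensorMap_smul_right, Abelian.Ext.mk₀_smul, Abelian.Ext.comp_smul]
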